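/- Let $\Sigma$ be an alphabet (finite or infinite). **HDAs.** A *lo-set* is a finite set $U$ with a strict total order $\dashrightarrow$ and a labelling $\lambda:U\to\Sigma$; an *ilo-set* ${}_SU_T$ is a lo-set $U$ with subsets $S,T\subseteq U$ (source and target interface). Let $\mathrm{I}\square$ be the category whose objects are isomorphism classes of ilo-sets and whose morphisms $d_{A,B}:U\to V$ (coface maps) are triples $(\partial,A,B)$, where $\partial:U\to V$ preserves order and labels, $S_U=\partial^{-1}(S_V)$, $T_U=\partial^{-1}(T_V)$, $A,B$ are disjoint with $A\cup B=V\setminus\partial(U)$, $A\cap S_V=\emptyset$ and $B\cap T_V=\emptyset$; the composite is $(\partial',C,D)\circ(\partial,A,B)=(\partial'\partial,\partial'(A)\cup C,\partial'(B)\cup D)$. Let $\square$ be its full subcategory of objects with empty interfaces. A *higher-dimensional automaton* (HDA) is a presheaf $X$ on $\square$ with finitely many cells (elements of the sets $X[U]$), with sets $X_\bot$, $X^\top$ of start and accept cells. A *higher-dimensional automaton with interfaces* (iHDA) is a presheaf $X$ on $\mathrm{I}\square$ with finitely many cells and sets $X_\bot$, $X^\top$ of cells such that $S=U$ for every start cell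 in $X[{}_SU_T]$ and $T=U$ for every accept cell in $X[{}_SU_T]$. Write $\delta^0_A=X[d_{A,\emptyset}]$ and $\delta^1_B=X[d_{\emptyset,B}]$, and $\mathrm{ev}(x)=U$ for $x\in X[{}_SU_T]$. **Ipomsets.** A *labelled iposet* is a finite set $P$ with strict partial orders $<$ (precedence) and $\dashrightarrow$ (event order) such that any two distinct elements are comparable by $<$ or by $\dashrightarrow$, a labelling $\lambda:P\to\Sigma$, a set $S_P\subseteq P$ of $<$-minimal elements and a set $T_P\subseteq P$ of $<$-maximal elements. A *subsumption* $P\to Q$ is a label-preserving bijection $f$ with $f(S_P)=S_Q$, $f(T_P)=T_Q$, such that $f(x)<f(y)$ implies $x<y$, and such that $x\dashrightarrow y$ implies $f(x)\dashrightarrow f(y)$ whenever $x,y$ are $<$-incomparable. Write $P\sqsubseteq Q$ if there is one. An *isomorphism* is a subsumption that is also an isomorphism of the precedence orders; an *ipomset* is an isomorphism class of labelled iposets. An ipomset is an *interval* ipomset if there are $b,e:P\to\mathbb R$ with $b\le e$ and $x<y\iff e(x)<b(y)$. Ilo-sets are regarded as ipomsets with empty precedence; $\epsilon$ is the empty ipomset.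 The *parallel composition* $P\parallel Q$ has carrier $P\sqcup Q$, the unions of the interfaces and of the precedence orders, and $x\dashrightarrow y$ iff this holds in $P$ or in $Q$, or $x\in P$ and $y\in Q$. The *gluing composition* $P*Q$ is defined if the lo-sets $T_P$ and $S_Q$ are isomorphic; its carrier is $P\sqcup Q$ with $T_P$ and $S_Q$ identified along the unique isomorphism, $S_{P*Q}=S_P$, $T_{P*Q}=T_Q$, its event order is the transitive closure of the union of those of $P$ and $Q$, and $x<y$ iff $x<_Py$, or $x<_Qy$, or $x\in P\setminus T_P$ and $y\in Q\setminus S_Q$. **Regular languages.** A path in $X$ is a sequence of cells in which consecutive cells are joined by steps: up-steps $\delta^0_A(x)\to x$, with ipomset ${}_{U\setminus A}U_U$, and down-steps $x\to\delta^1_B(x)$, with ipomset ${}_UU_{U\setminus B}$, where $U=\mathrm{ev}(x)$. The ipomset $\mathrm{ev}(\alpha)$ of a path $\alpha$ is the gluing composition of the ipomsets of its steps, and ${}_UU_U$ with $U=\mathrm{ev}(x)$ if $\alpha$ consists of the single cell $x$. Let $L(X)$ be the set of the ipomsets $\mathrm{ev}(\alpha)$ of all paths $\alpha$ from a start cell to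 an accept cell. A set of ipomsets is *regular* if it is $L(X)$ for some HDA or iHDA $X$. **Rational languages.** For a set $A$ of ipomsets let $A{\downarrow}$ be the set of interval ipomsets $P$ with $P\sqsubseteq Q$ for some $Q\in A$. For sets $L,M$ of ipomsets put $L*M=\{P*Q\mid P\in L,\ Q\in M,\ T_P\simeq S_Q\}{\downarrow}$, $L\parallel M=\{P\parallel Q\mid P\in L,\ Q\in M\}{\downarrow}$ and $L^+=\bigcup_{n\ge1}L^n$ with $L^1=L$, $L^{n+1}=L*L^n$. The class of *rational* languages is the smallest class that contains $\emptyset$, $\{\epsilon\}$ and $\{p\}$ for every ipomset $p$ with exactly one event (with any label $a\in\Sigma$ and any of the four choices of interfaces), and that is closed under $\cup$, $*$, $\parallel$ and ${}^+$. **Proposition.** Every regular language is rational. -/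

import Mathlib

universe u w

namespace HigherDim

open CategoryTheory

/-! ## Lo-sets with interfaces and the labelled precube category with interfaces -/

/-- An isomorphism class of ilo-sets over the alphabet `Λ`: a word over
`{a, •a, a•, •a•}`, with the positions of the word as events. -/
structure ILoSet (Λ : Type u) where
  /-- number of events -/
  n : ℕ
  /-- labelling -/
  label : Fin n → Λ
  /-- source interface -/
  src : Set (Fin n)
  /-- target interface -/
  tgt : Set (Fin n)

/-- A coface map `d_{A,B} : U → V`: it inserts the events of `A` (unstarted in `U`) and of `B`
(terminated in `U`). -/
@[ext]
structure ILoSet.Hom {Λ : Type u} (U V : ILoSet Λ) where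
  toFun : Fin U.n → Fin V.n
  A : Set (Fin V.n)
  B : Set (Fin V.n)
  strictMono : StrictMono toFun
  label_eq : ∀ i, V.label (toFun i) = U.label i
  src_iff : ∀ i, toFun i ∈ V.src ↔ i ∈ U.src
  tgt_iff : ∀ i, toFun i ∈ V.tgt ↔ i ∈ U.tgt
  union_eq : A ∪ B = (Set.range toFun)ᶜ
  disj : Disjoint A B
  A_src : Disjoint A V.src
  B_tgt : Disjoint B V.tgt

/-- The identity coface map `d_{∅,∅}`. -/
def ILoSet.Hom.id {Λ : Type u} (U : ILoSet Λ) : U.Hom U where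
  toFun := fun i => i
  A := ∅
  B := ∅
  strictMono := strictMono_id
  label_eq := fun _ => rfl
  src_iff := fun _ => Iff.rfl
  tgt_iff := fun _ => Iff.rfl
  union_eq := by ext i; simp
  disj := by simp
  A_src := by simp
  B_tgt := by simp

/-- The composite `d_{C,D} ∘ d_{A,B} = d_{∂(A) ∪ C, ∂(B) ∪ D}`, where `∂` is the map underlying
`d_{C,D}`. -/
def ILoSet.Hom.comp {Λ : Type u} {U V W : ILoSet Λ} (f : U.Hom V) (g : V.Hom W) : U.Hom W where
  toFun := fun i => g.toFun (f.toFun i)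
  A := g.toFun '' f.A ∪ g.A
  B := g.toFun '' f.B ∪ g.B
  strictMono := g.strictMono.comp f.strictMono
  label_eq := fun i => by rw [g.label_eq, f.label_eq]
  src_iff := fun i => by rw [g.src_iff, f.src_iff]
  tgt_iff := fun i => by rw [g.tgt_iff, f.tgt_iff]
  union_eq := by
    have hg := g.strictMono.injective
    have h1 := fun x => Set.ext_iff.mp f.union_eq x
    have h2 := fun x => Set.ext_iff.mp g.union_eq x
    ext x
    simp only [Set.mem_union, Set.mem_image, Set.mem_compl_iff, Set.mem_range] at h1 h2 ⊢
    constructor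
    · rintro ((⟨y, hy, rfl⟩ | hx) | (⟨y, hy, rfl⟩ | hx)) ⟨i, hi⟩
      · exact (h1 y).1 (Or.inl hy) ⟨i, hg hi⟩
      · exact (h2 x).1 (Or.inl hx) ⟨_, hi⟩
      · exact (h1 y).1 (Or.inr hy) ⟨i, hg hi⟩
      · exact (h2 x).1 (Or.inr hx) ⟨_, hi⟩
    · intro hx
      by_cases hr : ∃ y, g.toFun y = x
      · obtain ⟨y, rfl⟩ := hr
        rcases (h1 y).2 (fun ⟨i, hi⟩ => hx ⟨i, by rw [hi]⟩) with h | h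
        · exact Or.inl (Or.inl ⟨y, h, rfl⟩)
        · exact Or.inr (Or.inl ⟨y, h, rfl⟩)
      · rcases (h2 x).2 hr with h | h
        · exact Or.inl (Or.inr h)
        · exact Or.inr (Or.inr h)
  disj := by
    have hg := g.strictMono.injective
    have h1 := Set.disjoint_left.mp f.disj
    have h2 := Set.disjoint_left.mp g.disj
    have h3 := fun x => Set.ext_iff.mp g.union_eq x
    simp only [Set.mem_union, Set.mem_compl_iff, Set.mem_range] at h3
    rw [Set.disjoint_left]
    rintro x (⟨y, hy, rfl⟩ | hx) (⟨z, hz, hzy⟩ | hx')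
    · exact h1 hy (hg hzy ▸ hz)
    · exact (h3 _).1 (Or.inr hx') ⟨y, rfl⟩
    · exact (h3 _).1 (Or.inl hx) ⟨z, hzy⟩
    · exact h2 hx hx'
  A_src := by
    rw [Set.disjoint_left]
    rintro x (⟨y, hy, rfl⟩ | hx) h
    · exact Set.disjoint_left.mp f.A_src hy ((g.src_iff y).1 h)
    · exact Set.disjoint_left.mp g.A_src hx h
  B_tgt := by
    rw [Set.disjoint_left]
    rintro x (⟨y, hy, rfl⟩ | hx) h
    · exact Set.disjoint_left.mp f.B_tgt hy ((g.tgt_iff y).1 h)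
    · exact Set.disjoint_left.mp g.B_tgt hx h

/-- The labelled precube category with interfaces (in its skeletal form). -/
instance ILoSet.category {Λ : Type u} : Category.{0} (ILoSet Λ) where
  Hom := ILoSet.Hom
  id := ILoSet.Hom.id
  comp := ILoSet.Hom.comp
  id_comp := fun f => by
    apply ILoSet.Hom.ext <;> simp [ILoSet.Hom.comp, ILoSet.Hom.id]
  comp_id := fun f => by
    apply ILoSet.Hom.ext <;> simp [ILoSet.Hom.comp, ILoSet.Hom.id]
  assoc := fun f g h => by
    apply ILoSet.Hom.ext <;>
      simp [ILoSet.Hom.comp, Set.image_union, Set.image_image, Set.union_assoc]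

/-! ## Precubical sets with interfaces, HDAs and iHDAs -/

/-- A precubical set with interfaces: a presheaf on the category of ilo-sets. -/
abbrev IpcSet (Λ : Type u) := (ILoSet Λ)ᵒᵖ ⥤ Type w

/-- The cells of a precubical set with interfaces. -/
abbrev IpcSet.Cell {Λ : Type u} (X : IpcSet.{u, w} Λ) := Σ U : ILoSet Λ, X.obj (Opposite.op U)

/-- A finite precubical set with interfaces, with sets of start and accept cells. -/
structure Automaton (Λ : Type u) where
  toIpc : IpcSet.{u, w} Λ
  finite : Finite toIpc.Cell
  start : Set toIpc.Cell
  accept : Set toIpc.Cell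

/-- `X` is an HDA: its underlying precubical set has no interfaces (precubical sets, that is,
presheaves on the category of lo-sets, are regarded as precubical sets with interfaces
that have cells over ilo-sets with empty interfaces only). -/
def Automaton.IsHDA {Λ : Type u} (X : Automaton.{u, w} Λ) : Prop :=
  ∀ x : X.toIpc.Cell, x.1.src = ∅ ∧ x.1.tgt = ∅

/-- `X` is an iHDA: all events of start cells are source events and all events of accept cells
are target events. -/
def Automaton.IsIHDA {Λ : Type u} (X : Automaton.{u, w} Λ) : Prop :=
  (∀ x ∈ X.start, x.1.src = Set.univ) ∧ (∀ x ∈ X.accept, x.1.tgt = Set.univ)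

/-! ## Ipomsets -/

/-- A labelled iposet: precedence order `lt`, event order `ev`, source and target
interfaces `S` and `T`. -/
structure Iposet (Λ : Type u) where
  carrier : Type
  finite : Finite carrier
  lt : carrier → carrier → Prop
  ev : carrier → carrier → Prop
  lt_irrefl : ∀ x, ¬ lt x x
  lt_trans : ∀ x y z, lt x y → lt y z → lt x z
  ev_irrefl : ∀ x, ¬ ev x x
  ev_trans : ∀ x y z, ev x y → ev y z → ev x z
  comparable : ∀ x y, x = y ∨ lt x y ∨ lt y x ∨ ev x y ∨ ev y x
  label : carrier → Λ
  S : Set carrier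
  T : Set carrier
  S_minimal : ∀ x ∈ S, ∀ y, ¬ lt y x
  T_maximal : ∀ x ∈ T, ∀ y, ¬ lt x y

/-- `f` is a subsumption: a bijection that respects labels and interfaces, reflects precedence
and preserves the event order of concurrent events. -/
structure Iposet.IsSubsumption {Λ : Type u} (P Q : Iposet Λ) (f : P.carrier ≃ Q.carrier) :
    Prop where
  label_eq : ∀ x, Q.label (f x) = P.label x
  S_iff : ∀ x, f x ∈ Q.S ↔ x ∈ P.S
  T_iff : ∀ x, f x ∈ Q.T ↔ x ∈ P.T
  reflects : ∀ x y, Q.lt (f x) (f y) → P.lt x y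
  preserves : ∀ x y, P.ev x y → ¬ P.lt x y → ¬ P.lt y x → Q.ev (f x) (f y)

/-- `P ⊑ Q` for labelled iposets. -/
def Iposet.Subsumed {Λ : Type u} (P Q : Iposet Λ) : Prop :=
  ∃ f : P.carrier ≃ Q.carrier, P.IsSubsumption Q f

/-- Isomorphism of labelled iposets: a subsumption that is an isomorphism of precedence orders
(its inverse is then a subsumption, too). -/
def Iposet.Isomorphic {Λ : Type u} (P Q : Iposet Λ) : Prop :=
  ∃ f : P.carrier ≃ Q.carrier, P.IsSubsumption Q f ∧ ∀ x y, P.lt x y ↔ Q.lt (f x) (f y)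

theorem Iposet.Subsumed.trans {Λ : Type u} {P Q R : Iposet Λ} (h : P.Subsumed Q)
    (k : Q.Subsumed R) : P.Subsumed R := by
  obtain ⟨f, hf⟩ := h
  obtain ⟨g, hg⟩ := k
  refine ⟨f.trans g, ⟨fun x => ?_, fun x => ?_, fun x => ?_, fun x y h => ?_,
    fun x y h h1 h2 => ?_⟩⟩
  · simp [hg.label_eq, hf.label_eq]
  · simp [hg.S_iff, hf.S_iff]
  · simp [hg.T_iff, hf.T_iff]
  · exact hf.reflects _ _ (hg.reflects _ _ h)
  · exact hg.preserves _ _ (hf.preserves _ _ h h1 h2) (fun h => h1 (hf.reflects _ _ h))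
      (fun h => h2 (hf.reflects _ _ h))

theorem Iposet.Isomorphic.subsumed {Λ : Type u} {P Q : Iposet Λ} (h : P.Isomorphic Q) :
    P.Subsumed Q := ⟨h.choose, h.choose_spec.1⟩

theorem Iposet.Isomorphic.refl {Λ : Type u} (P : Iposet Λ) : P.Isomorphic P :=
  ⟨Equiv.refl _, ⟨fun _ => rfl, fun _ => Iff.rfl, fun _ => Iff.rfl, fun _ _ h => h,
    fun _ _ h _ _ => h⟩, fun _ _ => Iff.rfl⟩

theorem Iposet.Isomorphic.symm {Λ : Type u} {P Q : Iposet Λ} (h : P.Isomorphic Q) :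
    Q.Isomorphic P := by
  obtain ⟨f, hf, hlt⟩ := h
  refine ⟨f.symm, ⟨fun x => ?_, fun x => ?_, fun x => ?_, fun x y h => ?_,
    fun x y h h1 h2 => ?_⟩, fun x y => ?_⟩
  · simpa using (hf.label_eq (f.symm x)).symm
  · simpa using (hf.S_iff (f.symm x)).symm
  · simpa using (hf.T_iff (f.symm x)).symm
  · simpa using (hlt _ _).1 h
  · have h1' : ¬ P.lt (f.symm x) (f.symm y) := fun h => h1 (by simpa using (hlt _ _).1 h)
    have h2' : ¬ P.lt (f.symm y) (f.symm x) := fun h => h2 (by simpa using (hlt _ _).1 h)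
    rcases P.comparable (f.symm x) (f.symm y) with e | e | e | e | e
    · rw [f.symm.injective e] at h
      exact absurd h (Q.ev_irrefl _)
    · exact absurd e h1'
    · exact absurd e h2'
    · exact e
    · have := hf.preserves _ _ e h2' h1'
      simp only [Equiv.apply_symm_apply] at this
      exact absurd (Q.ev_trans _ _ _ h this) (Q.ev_irrefl _)
  · simpa using (hlt (f.symm x) (f.symm y)).symm

theorem Iposet.Isomorphic.trans {Λ : Type u} {P Q R : Iposet Λ} (h : P.Isomorphic Q)
    (k : Q.Isomorphic R) : P.Isomorphic R := by
  obtain ⟨f, hf, hlt⟩ := h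
  obtain ⟨g, hg, klt⟩ := k
  refine ⟨f.trans g, ⟨fun x => ?_, fun x => ?_, fun x => ?_, fun x y h => ?_,
    fun x y h h1 h2 => ?_⟩, fun x y => ?_⟩
  · simp [hg.label_eq, hf.label_eq]
  · simp [hg.S_iff, hf.S_iff]
  · simp [hg.T_iff, hf.T_iff]
  · exact hf.reflects _ _ (hg.reflects _ _ h)
  · exact hg.preserves _ _ (hf.preserves _ _ h h1 h2) (fun h => h1 (hf.reflects _ _ h))
      (fun h => h2 (hf.reflects _ _ h))
  · exact (hlt x y).trans (klt _ _)

instance Iposet.setoid (Λ : Type u) : Setoid (Iposet Λ) where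
  r := Iposet.Isomorphic
  iseqv := ⟨Iposet.Isomorphic.refl, Iposet.Isomorphic.symm, Iposet.Isomorphic.trans⟩

/-- An ipomset is an isomorphism class of labelled iposets. -/
def Ipomset (Λ : Type u) := Quotient (Iposet.setoid Λ)

/-- The isomorphism class of a labelled iposet. -/
def Ipomset.mk {Λ : Type u} (P : Iposet Λ) : Ipomset Λ := Quotient.mk (Iposet.setoid Λ) P

/-- `P ⊑ Q` for ipomsets. -/
def Ipomset.Subsumed {Λ : Type u} (P Q : Ipomset Λ) : Prop :=
  Quotient.liftOn₂ P Q Iposet.Subsumed fun _ _ _ _ h k => propext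
    ⟨fun hs => (Iposet.Isomorphic.symm h).subsumed.trans
        (hs.trans (Iposet.Isomorphic.subsumed k)),
      fun hs => (Iposet.Isomorphic.subsumed h).trans
        (hs.trans (Iposet.Isomorphic.symm k).subsumed)⟩

/-- `P` admits an interval representation. -/
def Iposet.IsInterval {Λ : Type u} (P : Iposet Λ) : Prop :=
  ∃ b e : P.carrier → ℝ, (∀ x, b x ≤ e x) ∧ ∀ x y, P.lt x y ↔ e x < b y

theorem Iposet.IsInterval.of_iso {Λ : Type u} {P Q : Iposet Λ} (h : P.Isomorphic Q)
    (hQ : Q.IsInterval) : P.IsInterval := by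
  obtain ⟨f, -, hlt⟩ := h
  obtain ⟨b, e, hbe, hr⟩ := hQ
  exact ⟨fun x => b (f x), fun x => e (f x), fun x => hbe _,
    fun x y => (hlt x y).trans (hr _ _)⟩

/-- Interval ipomsets. -/
def Ipomset.IsInterval {Λ : Type u} (P : Ipomset Λ) : Prop :=
  Quotient.liftOn P Iposet.IsInterval fun _ _ h => propext
    ⟨Iposet.IsInterval.of_iso (Iposet.Isomorphic.symm h), Iposet.IsInterval.of_iso h⟩

/-- An ilo-set regarded as a discrete labelled iposet. -/
def ILoSet.toIposet {Λ : Type u} (U : ILoSet Λ) : Iposet Λ where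
  carrier := Fin U.n
  finite := inferInstance
  lt := fun _ _ => False
  ev := fun i j => i < j
  lt_irrefl := fun _ h => h
  lt_trans := fun _ _ _ h _ => h
  ev_irrefl := fun i => lt_irrefl i
  ev_trans := fun _ _ _ h k => h.trans k
  comparable := fun i j => by rcases lt_trichotomy i j with h | h | h <;> simp [h]
  label := U.label
  S := U.src
  T := U.tgt
  S_minimal := fun _ _ _ h => h
  T_maximal := fun _ _ _ h => h

/-- The empty ipomset. -/
def Ipomset.empty (Λ : Type u) : Ipomset Λ :=
  Ipomset.mk (ILoSet.toIposet ⟨0, fun i => i.elim0, ∅, ∅⟩)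

/-- The singleton ipomsets `a`, `•a`, `a•` and `•a•`; `s` and `t` tell whether the event belongs
to the source and to the target interface. -/
def Ipomset.single {Λ : Type u} (a : Λ) (s t : Bool) : Ipomset Λ :=
  Ipomset.mk (ILoSet.toIposet ⟨1, fun _ => a, {_i | s = true}, {_i | t = true}⟩)

/-- Parallel composition. -/
def Iposet.par {Λ : Type u} (P Q : Iposet Λ) : Iposet Λ where
  carrier := P.carrier ⊕ Q.carrier
  finite := by
    have := P.finite
    have := Q.finite
    infer_instance
  lt := Sum.LiftRel P.lt Q.lt
  ev := Sum.Lex P.ev Q.ev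
  lt_irrefl := by
    rintro (x | x) h <;> cases h
    · exact P.lt_irrefl _ ‹_›
    · exact Q.lt_irrefl _ ‹_›
  lt_trans := by
    rintro _ _ _ (h | h) (k | k)
    · exact Sum.LiftRel.inl (P.lt_trans _ _ _ h k)
    · exact Sum.LiftRel.inr (Q.lt_trans _ _ _ h k)
  ev_irrefl := by
    rintro (x | x) h <;> cases h
    · exact P.ev_irrefl _ ‹_›
    · exact Q.ev_irrefl _ ‹_›
  ev_trans := by
    rintro (x | x) (y | y) (z | z) h k <;> simp only [Sum.lex_inl_inl, Sum.lex_inr_inr,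
      Sum.lex_inr_inl, Sum.Lex.sep] at h k ⊢
    · exact P.ev_trans _ _ _ h k
    · exact Q.ev_trans _ _ _ h k
  comparable := by
    rintro (x | x) (y | y)
    · simpa using P.comparable x y
    · simp
    · simp
    · simpa using Q.comparable x y
  label := Sum.elim P.label Q.label
  S := Sum.inl '' P.S ∪ Sum.inr '' Q.S
  T := Sum.inl '' P.T ∪ Sum.inr '' Q.T
  S_minimal := by
    rintro _ (⟨x, hx, rfl⟩ | ⟨x, hx, rfl⟩) _ (h | h)
    · exact P.S_minimal _ hx _ h
    · exact Q.S_minimal _ hx _ h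
  T_maximal := by
    rintro _ (⟨x, hx, rfl⟩ | ⟨x, hx, rfl⟩) _ (h | h)
    · exact P.T_maximal _ hx _ h
    · exact Q.T_maximal _ hx _ h

/-- The isomorphisms between two labelled sets equipped with relations (lo-isomorphisms, if the
relations are strict total orders). -/
def LoIso {Λ : Type u} {α β : Type} (r : α → α → Prop) (l : α → Λ) (s : β → β → Prop)
    (m : β → Λ) : Type :=
  {f : r ≃r s // ∀ x, m (f x) = l x}

/-- Lo-isomorphisms `T_P ≃ S_Q`; there is at most one. -/
def Iposet.Matching {Λ : Type u} (P Q : Iposet Λ) : Type :=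
  LoIso (fun x y : P.T => P.ev x y) (fun x : P.T => P.label x)
    (fun x y : Q.S => Q.ev x y) (fun x : Q.S => Q.label x)

/-- The carrier of the gluing composition: the quotient of `P ⊔ Q` that identifies `T_P` with
`S_Q`, represented as the disjoint union of `P` and `Q \ S_Q`. -/
abbrev Iposet.GlueCarrier {Λ : Type u} (P Q : Iposet Λ) : Type :=
  P.carrier ⊕ {y : Q.carrier // y ∉ Q.S}

open Classical in
/-- The structural inclusion of `Q` into the gluing composition of `P` and `Q`. -/
noncomputable def Iposet.glueInr {Λ : Type u} (P Q : Iposet Λ) (f : P.Matching Q)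
    (y : Q.carrier) : P.GlueCarrier Q :=
  if h : y ∈ Q.S then Sum.inl (f.1.symm ⟨y, h⟩).1 else Sum.inr ⟨y, h⟩

/-- The precedence order of the gluing composition. -/
inductive Iposet.GlueLt {Λ : Type u} (P Q : Iposet Λ) (f : P.Matching Q) :
    P.GlueCarrier Q → P.GlueCarrier Q → Prop
  | left (x y : P.carrier) : P.lt x y → GlueLt P Q f (Sum.inl x) (Sum.inl y)
  | right (x y : Q.carrier) : Q.lt x y → GlueLt P Q f (P.glueInr Q f x) (P.glueInr Q f y)
  | cross (x : P.carrier) (y : Q.carrier) : x ∉ P.T → y ∉ Q.S →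
      GlueLt P Q f (Sum.inl x) (P.glueInr Q f y)

/-- The union of the event orders of `P` and `Q` in the gluing composition. -/
inductive Iposet.GlueEvBase {Λ : Type u} (P Q : Iposet Λ) (f : P.Matching Q) :
    P.GlueCarrier Q → P.GlueCarrier Q → Prop
  | left (x y : P.carrier) : P.ev x y → GlueEvBase P Q f (Sum.inl x) (Sum.inl y)
  | right (x y : Q.carrier) : Q.ev x y →
      GlueEvBase P Q f (P.glueInr Q f x) (P.glueInr Q f y)

theorem Iposet.glueInr_mem {Λ : Type u} (P Q : Iposet Λ) (f : P.Matching Q) (t : P.T) :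
    P.glueInr Q f (f.1 t) = Sum.inl t.1 := by
  simp [Iposet.glueInr]

theorem Iposet.glueInr_notMem {Λ : Type u} (P Q : Iposet Λ) (f : P.Matching Q) (y : Q.carrier)
    (h : y ∉ Q.S) : P.glueInr Q f y = Sum.inr ⟨y, h⟩ := by
  simp [Iposet.glueInr, h]

theorem Iposet.glueInr_cases {Λ : Type u} (P Q : Iposet Λ) (f : P.Matching Q) (y : Q.carrier) :
    (∃ t : P.T, y = f.1 t ∧ P.glueInr Q f y = Sum.inl t.1) ∨
      ∃ h : y ∉ Q.S, P.glueInr Q f y = Sum.inr ⟨y, h⟩ := by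
  by_cases h : y ∈ Q.S
  · exact Or.inl ⟨f.1.symm ⟨y, h⟩, by simp, by simp [Iposet.glueInr, h]⟩
  · exact Or.inr ⟨h, P.glueInr_notMem Q f y h⟩

/-- Explicit form of the precedence order of the gluing composition. -/
def Iposet.GlueLtCases {Λ : Type u} (P Q : Iposet Λ) (f : P.Matching Q) :
    P.GlueCarrier Q → P.GlueCarrier Q → Prop
  | Sum.inl x, Sum.inl y => P.lt x y
  | Sum.inl x, Sum.inr y => x ∉ P.T ∨ ∃ t : P.T, x = t.1 ∧ Q.lt (f.1 t) y
  | Sum.inr _, Sum.inl _ => False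
  | Sum.inr x, Sum.inr y => Q.lt x y

theorem Iposet.glueLt_iff {Λ : Type u} (P Q : Iposet Λ) (f : P.Matching Q)
    (a b : P.GlueCarrier Q) : P.GlueLt Q f a b ↔ P.GlueLtCases Q f a b := by
  constructor
  · rintro (⟨x, y, h⟩ | ⟨x, y, h⟩ | ⟨x, y, hx, hy⟩)
    · exact h
    · rcases P.glueInr_cases Q f y with ⟨t, rfl, -⟩ | ⟨hy, ey⟩
      · exact absurd h (Q.S_minimal _ (f.1 t).2 _)
      · rw [ey]
        rcases P.glueInr_cases Q f x with ⟨t, rfl, ex⟩ | ⟨hx, ex⟩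
        · rw [ex]; exact Or.inr ⟨t, rfl, h⟩
        · rw [ex]; exact h
    · rw [P.glueInr_notMem Q f y hy]
      exact Or.inl hx
  · intro h
    rcases a with x | x <;> rcases b with y | y
    · exact GlueLt.left x y h
    · rw [show (Sum.inr y : P.GlueCarrier Q) = P.glueInr Q f y.1 from
        (P.glueInr_notMem Q f y.1 y.2).symm]
      rcases h with h | ⟨t, rfl, h⟩
      · exact GlueLt.cross x y.1 h y.2
      · rw [← P.glueInr_mem Q f t]
        exact GlueLt.right _ _ h
    · exact h.elim
    · rw [show (Sum.inr y : P.GlueCarrier Q) = P.glueInr Q f y.1 from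
        (P.glueInr_notMem Q f y.1 y.2).symm,
        show (Sum.inr x : P.GlueCarrier Q) = P.glueInr Q f x.1 from
        (P.glueInr_notMem Q f x.1 x.2).symm]
      exact GlueLt.right _ _ h

/-- Explicit form of the event order of the gluing composition. -/
def Iposet.GlueEvCases {Λ : Type u} (P Q : Iposet Λ) (f : P.Matching Q) :
    P.GlueCarrier Q → P.GlueCarrier Q → Prop
  | Sum.inl x, Sum.inl y => P.ev x y
  | Sum.inl x, Sum.inr y => ∃ t : P.T, (x = t.1 ∨ P.ev x t.1) ∧ Q.ev (f.1 t) y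
  | Sum.inr x, Sum.inl y => ∃ t : P.T, Q.ev x (f.1 t) ∧ (t.1 = y ∨ P.ev t.1 y)
  | Sum.inr x, Sum.inr y => Q.ev x y

theorem Iposet.Matching.ev_iff {Λ : Type u} {P Q : Iposet Λ} (f : P.Matching Q) (s t : P.T) :
    Q.ev (f.1 s) (f.1 t) ↔ P.ev s t := f.1.map_rel_iff (a := s) (b := t)

theorem Iposet.glueEvCases_trans {Λ : Type u} (P Q : Iposet Λ) (f : P.Matching Q)
    (a b c : P.GlueCarrier Q) (h : P.GlueEvCases Q f a b) (k : P.GlueEvCases Q f b c) :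
    P.GlueEvCases Q f a c := by
  have hP := P.ev_trans
  have hQ := Q.ev_trans
  have hf := f.ev_iff
  rcases a with x | x <;> rcases b with y | y <;> rcases c with z | z <;>
    simp only [Iposet.GlueEvCases] at h k ⊢
  · exact hP _ _ _ h k
  · obtain ⟨t, ht, k⟩ := k
    exact ⟨t, Or.inr (by rcases ht with rfl | ht; exacts [h, hP _ _ _ h ht]), k⟩
  · obtain ⟨t, ht, h⟩ := h
    obtain ⟨s, k, hs⟩ := k
    have hts := (hf t s).1 (hQ _ _ _ h k)
    have h1 : P.ev x s := by rcases ht with rfl | ht; exacts [hts, hP _ _ _ ht hts]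
    rcases hs with rfl | hs
    exacts [h1, hP _ _ _ h1 hs]
  · obtain ⟨t, ht, h⟩ := h
    exact ⟨t, ht, hQ _ _ _ h k⟩
  · obtain ⟨t, h, ht⟩ := h
    exact ⟨t, h, Or.inr (by rcases ht with rfl | ht; exacts [k, hP _ _ _ ht k])⟩
  · obtain ⟨t, h, ht⟩ := h
    obtain ⟨s, hs, k⟩ := k
    have hts : t = s ∨ P.ev t s := by
      rcases ht with rfl | ht <;> rcases hs with e | hs
      · exact Or.inl (Subtype.ext e)
      · exact Or.inr hs
      · exact Or.inr (e ▸ ht)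
      · exact Or.inr (hP _ _ _ ht hs)
    rcases hts with rfl | hts
    · exact hQ _ _ _ h k
    · exact hQ _ _ _ h (hQ _ _ _ ((hf t s).2 hts) k)
  · obtain ⟨t, k, ht⟩ := k
    exact ⟨t, hQ _ _ _ h k, ht⟩
  · exact hQ _ _ _ h k

theorem Iposet.glueEv_cases {Λ : Type u} (P Q : Iposet Λ) (f : P.Matching Q)
    (a b : P.GlueCarrier Q) (h : Relation.TransGen (P.GlueEvBase Q f) a b) :
    P.GlueEvCases Q f a b := by
  have base : ∀ a b, P.GlueEvBase Q f a b → P.GlueEvCases Q f a b := by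
    rintro _ _ (⟨x, y, h⟩ | ⟨x, y, h⟩)
    · exact h
    · rcases P.glueInr_cases Q f x with ⟨t, rfl, ex⟩ | ⟨hx, ex⟩ <;>
        rcases P.glueInr_cases Q f y with ⟨s, rfl, ey⟩ | ⟨hy, ey⟩ <;> rw [ex, ey]
      · exact (f.ev_iff t s).1 h
      · exact ⟨t, Or.inl rfl, h⟩
      · exact ⟨s, h, Or.inl rfl⟩
      · exact h
  induction h with
  | single h => exact base _ _ h
  | tail _ h ih => exact P.glueEvCases_trans Q f _ _ _ ih (base _ _ h)

/-- The gluing composition `P * Q` along the isomorphism `f : T_P ≃ S_Q`. -/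
noncomputable def Iposet.glue {Λ : Type u} (P Q : Iposet Λ) (f : P.Matching Q) : Iposet Λ where
  carrier := P.GlueCarrier Q
  finite := by
    have := P.finite
    have := Q.finite
    infer_instance
  lt := P.GlueLt Q f
  ev := Relation.TransGen (P.GlueEvBase Q f)
  lt_irrefl := fun x h => by
    rw [P.glueLt_iff] at h
    rcases x with x | x
    · exact P.lt_irrefl _ h
    · exact Q.lt_irrefl _ h
  lt_trans := fun x y z h k => by
    rw [P.glueLt_iff] at h k ⊢
    rcases x with x | x <;> rcases y with y | y <;> rcases z with z | z <;>
      simp only [Iposet.GlueLtCases] at h k ⊢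
    · exact P.lt_trans _ _ _ h k
    · exact Or.inl fun hx => P.T_maximal _ hx _ h
    · rcases h with h | ⟨t, rfl, h⟩
      · exact Or.inl h
      · exact Or.inr ⟨t, rfl, Q.lt_trans _ _ _ h k⟩
    · exact Q.lt_trans _ _ _ h k
  ev_irrefl := fun x h => by
    have h := P.glueEv_cases Q f _ _ h
    rcases x with x | x
    · exact P.ev_irrefl _ h
    · exact Q.ev_irrefl _ h
  ev_trans := fun _ _ _ h k => h.trans k
  comparable := fun a b => by
    have key : ∀ (x : P.carrier) (y : {y : Q.carrier // y ∉ Q.S}),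
        P.GlueLt Q f (Sum.inl x) (Sum.inr y) ∨
        Relation.TransGen (P.GlueEvBase Q f) (Sum.inl x) (Sum.inr y) ∨
        Relation.TransGen (P.GlueEvBase Q f) (Sum.inr y) (Sum.inl x) := by
      intro x y
      have ey := P.glueInr_notMem Q f y.1 y.2
      by_cases hx : x ∈ P.T
      · have ex := P.glueInr_mem Q f ⟨x, hx⟩
        rcases Q.comparable (f.1 ⟨x, hx⟩) y.1 with e | e | e | e | e
        · exact absurd (e ▸ (f.1 ⟨x, hx⟩).2) y.2
        · exact Or.inl ((P.glueLt_iff Q f _ _).2 (Or.inr ⟨⟨x, hx⟩, rfl, e⟩))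
        · exact absurd e (Q.S_minimal _ (f.1 ⟨x, hx⟩).2 _)
        · have := GlueEvBase.right (P := P) (f := f) _ _ e
          rw [ex, ey] at this
          exact Or.inr (Or.inl (Relation.TransGen.single this))
        · have := GlueEvBase.right (P := P) (f := f) _ _ e
          rw [ex, ey] at this
          exact Or.inr (Or.inr (Relation.TransGen.single this))
      · exact Or.inl ((P.glueLt_iff Q f _ _).2 (Or.inl hx))
    rcases a with x | x <;> rcases b with y | y
    · rcases P.comparable x y with rfl | e | e | e | e
      · exact Or.inl rfl
      · exact Or.inr (Or.inl (GlueLt.left _ _ e))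
      · exact Or.inr (Or.inr (Or.inl (GlueLt.left _ _ e)))
      · exact Or.inr (Or.inr (Or.inr (Or.inl (Relation.TransGen.single
          (GlueEvBase.left _ _ e)))))
      · exact Or.inr (Or.inr (Or.inr (Or.inr (Relation.TransGen.single
          (GlueEvBase.left _ _ e)))))
    · rcases key x y with e | e | e <;> simp [e]
    · rcases key y x with e | e | e <;> simp [e]
    · have ex := P.glueInr_notMem Q f x.1 x.2
      have ey := P.glueInr_notMem Q f y.1 y.2
      rcases Q.comparable x.1 y.1 with e | e | e | e | e
      · exact Or.inl (by rw [Subtype.ext e])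
      · exact Or.inr (Or.inl ((P.glueLt_iff Q f _ _).2 e))
      · exact Or.inr (Or.inr (Or.inl ((P.glueLt_iff Q f _ _).2 e)))
      · have := GlueEvBase.right (P := P) (f := f) _ _ e
        rw [ex, ey] at this
        exact Or.inr (Or.inr (Or.inr (Or.inl (Relation.TransGen.single this))))
      · have := GlueEvBase.right (P := P) (f := f) _ _ e
        rw [ex, ey] at this
        exact Or.inr (Or.inr (Or.inr (Or.inr (Relation.TransGen.single this))))
  label := Sum.elim P.label fun y => Q.label y.1
  S := Sum.inl '' P.S
  T := P.glueInr Q f '' Q.T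
  S_minimal := by
    rintro _ ⟨x, hx, rfl⟩ y h
    rw [P.glueLt_iff] at h
    rcases y with y | y
    · exact P.S_minimal _ hx _ h
    · exact h
  T_maximal := by
    rintro _ ⟨x, hx, rfl⟩ y h
    rw [P.glueLt_iff] at h
    rcases P.glueInr_cases Q f x with ⟨t, rfl, ex⟩ | ⟨hx', ex⟩ <;> rw [ex] at h <;>
      rcases y with y | y
    · exact P.T_maximal _ t.2 _ h
    · rcases h with h | ⟨s, hs, h⟩
      · exact h t.2
      · rw [← Subtype.ext hs] at h
        exact Q.T_maximal _ hx _ h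
    · exact h
    · exact Q.T_maximal _ hx _ h

/-! ## Rational languages -/

/-- The down-closure of a set of ipomsets, within interval ipomsets. -/
def down {Λ : Type u} (A : Set (Ipomset Λ)) : Set (Ipomset Λ) :=
  {P | P.IsInterval ∧ ∃ Q ∈ A, P.Subsumed Q}

/-- The gluing composition of languages. -/
def langGlue {Λ : Type u} (L M : Set (Ipomset Λ)) : Set (Ipomset Λ) :=
  down {R | ∃ (P Q : Iposet Λ) (f : P.Matching Q),
    Ipomset.mk P ∈ L ∧ Ipomset.mk Q ∈ M ∧ R = Ipomset.mk (P.glue Q f)}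

/-- The parallel composition of languages. -/
def langPar {Λ : Type u} (L M : Set (Ipomset Λ)) : Set (Ipomset Λ) :=
  down {R | ∃ P Q : Iposet Λ,
    Ipomset.mk P ∈ L ∧ Ipomset.mk Q ∈ M ∧ R = Ipomset.mk (P.par Q)}

/-- `langPow L n` is the power of `L` with exponent `n + 1`. -/
def langPow {Λ : Type u} (L : Set (Ipomset Λ)) : ℕ → Set (Ipomset Λ)
  | 0 => L
  | n + 1 => langGlue L (langPow L n)

/-- Kleene plus. -/
def langPlus {Λ : Type u} (L : Set (Ipomset Λ)) : Set (Ipomset Λ) := ⋃ n, langPow L n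

/-- The smallest class that contains the empty language, the language of the empty ipomset and
the languages of the singleton ipomsets, and that is closed under union, gluing composition,
parallel composition and Kleene plus. -/
inductive IsRational {Λ : Type u} : Set (Ipomset Λ) → Prop
  | empty : IsRational ∅
  | epsilon : IsRational {Ipomset.empty Λ}
  | single (a : Λ) (s t : Bool) : IsRational {Ipomset.single a s t}
  | union (L M : Set (Ipomset Λ)) : IsRational L → IsRational M → IsRational (L ∪ M)
  | glue (L M : Set (Ipomset Λ)) : IsRational L → IsRational M → IsRational (langGlue L M)
  | par (L M : Set (Ipomset Λ)) : IsRational L → IsRational M → IsRational (langPar L M)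
  | plus (L : Set (Ipomset Λ)) : IsRational L → IsRational (langPlus L)

/-! ## Paths and regular languages -/

/-- Up-steps and down-steps between cells. -/
inductive Step {Λ : Type u} (X : IpcSet.{u, w} Λ) : X.Cell → X.Cell → Type (max u w)
  | up {x y : X.Cell} (φ : x.1 ⟶ y.1) (hB : φ.B = ∅) (h : X.map φ.op y.2 = x.2) : Step X x y
  | down {x y : X.Cell} (φ : y.1 ⟶ x.1) (hA : φ.A = ∅) (h : X.map φ.op x.2 = y.2) : Step X x y

/-- Paths, as sequences of steps. -/
inductive Path {Λ : Type u} (X : IpcSet.{u, w} Λ) : X.Cell → X.Cell → Type (max u w)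
  | nil (x : X.Cell) : Path X x x
  | cons {x y z : X.Cell} (s : Step X x y) (p : Path X y z) : Path X x z

/-- The ilo-set with the underlying lo-set of `U` and the interfaces `S` and `T`. -/
def ILoSet.withInterfaces {Λ : Type u} (U : ILoSet Λ) (S T : Set (Fin U.n)) : ILoSet Λ :=
  ⟨U.n, U.label, S, T⟩

/-- The labelled iposet of a step: source `U \ A` and target `U` for an up-step that starts `A`,
source `U` and target `U \ B` for a down-step that terminates `B`. -/
def Step.ev {Λ : Type u} {X : IpcSet.{u, w} Λ} {x y : X.Cell} : Step X x y → Iposet Λ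
  | .up φ _ _ => (y.1.withInterfaces φ.Aᶜ Set.univ).toIposet
  | .down φ _ _ => (x.1.withInterfaces Set.univ φ.Bᶜ).toIposet

/-- Lo-isomorphisms from the lo-set underlying `U` to the source interface of `P`. -/
def ILoSet.SrcIso {Λ : Type u} (U : ILoSet Λ) (P : Iposet Λ) : Type :=
  LoIso (fun i j : Fin U.n => i < j) U.label (fun x y : P.S => P.ev x y)
    (fun x : P.S => P.label x)

/-- Lo-isomorphisms from the target interface of `P` to the lo-set underlying `U`. -/
def ILoSet.TgtIso {Λ : Type u} (U : ILoSet Λ) (P : Iposet Λ) : Type :=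
  LoIso (fun x y : P.T => P.ev x y) (fun x : P.T => P.label x)
    (fun i j : Fin U.n => i < j) U.label

/-- Composition of lo-isomorphisms. -/
def LoIso.trans {Λ : Type u} {α β γ : Type} {r : α → α → Prop} {l : α → Λ}
    {s : β → β → Prop} {m : β → Λ} {t : γ → γ → Prop} {k : γ → Λ}
    (f : LoIso r l s m) (g : LoIso s m t k) : LoIso r l t k :=
  ⟨f.1.trans g.1, fun x => (g.2 _).trans (f.2 x)⟩

/-- Inverse of a lo-isomorphism. -/
def LoIso.symm {Λ : Type u} {α β : Type} {r : α → α → Prop} {l : α → Λ}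
    {s : β → β → Prop} {m : β → Λ} (f : LoIso r l s m) : LoIso s m r l :=
  ⟨f.1.symm, fun x => by simpa using (f.2 (f.1.symm x)).symm⟩

/-- The whole lo-set as a subset of itself. -/
def ILoSet.univIso {Λ : Type u} (U : ILoSet Λ) :
    LoIso (fun i j : Fin U.n => i < j) U.label
      (fun x y : (Set.univ : Set (Fin U.n)) => x.1 < y.1) (fun x => U.label x.1) :=
  ⟨⟨(Equiv.Set.univ (Fin U.n)).symm, Iff.rfl⟩, fun _ => rfl⟩

/-- A coface map identifies its domain with a subset of its codomain. -/
noncomputable def ILoSet.Hom.rangeIso {Λ : Type u} {U V : ILoSet Λ} (φ : U.Hom V)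
    (C : Set (Fin V.n)) (hC : Set.range φ.toFun = C) :
    LoIso (fun i j : Fin U.n => i < j) U.label
      (fun x y : C => x.1 < y.1) (fun x => V.label x.1) :=
  ⟨⟨(Equiv.ofInjective φ.toFun φ.strictMono.injective).trans (Equiv.setCongr hC),
    fun {_ _} => φ.strictMono.lt_iff_lt⟩, fun i => φ.label_eq i⟩

theorem ILoSet.Hom.range_of_B {Λ : Type u} {U V : ILoSet Λ} (φ : U.Hom V) (h : φ.B = ∅) :
    Set.range φ.toFun = φ.Aᶜ := by
  have := φ.union_eq
  rw [h, Set.union_empty] at this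
  rw [this, compl_compl]

theorem ILoSet.Hom.range_of_A {Λ : Type u} {U V : ILoSet Λ} (φ : U.Hom V) (h : φ.A = ∅) :
    Set.range φ.toFun = φ.Bᶜ := by
  have := φ.union_eq
  rw [h, Set.empty_union] at this
  rw [this, compl_compl]

/-- The source interface of a step is the lo-set of its source cell. -/
noncomputable def Step.srcIso {Λ : Type u} {X : IpcSet.{u, w} Λ} {x y : X.Cell} :
    (s : Step X x y) → x.1.SrcIso s.ev
  | .up φ hB _ => ILoSet.Hom.rangeIso φ _ (ILoSet.Hom.range_of_B φ hB)
  | .down _ _ _ => x.1.univIso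

/-- The target interface of a step is the lo-set of its target cell. -/
noncomputable def Step.tgtIso {Λ : Type u} {X : IpcSet.{u, w} Λ} {x y : X.Cell} :
    (s : Step X x y) → y.1.TgtIso s.ev
  | .up _ _ _ => y.1.univIso.symm
  | .down φ hA _ => (ILoSet.Hom.rangeIso φ _ (ILoSet.Hom.range_of_A φ hA)).symm

/-- The source interface of a gluing composition. -/
noncomputable def Iposet.glueSrcIso {Λ : Type u} (P Q : Iposet Λ) (f : P.Matching Q) :
    LoIso (fun x y : P.S => P.ev x y) (fun x : P.S => P.label x)
      (fun x y : (P.glue Q f).S => (P.glue Q f).ev x y)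
      (fun x : (P.glue Q f).S => (P.glue Q f).label x) :=
  ⟨⟨Equiv.Set.image Sum.inl P.S Sum.inl_injective, fun {x y} =>
    ⟨fun h => P.glueEv_cases Q f (Sum.inl x.1) (Sum.inl y.1) h,
      fun h => Relation.TransGen.single (GlueEvBase.left x.1 y.1 h)⟩⟩, fun _ => rfl⟩

/-- The labelled iposet of a path, with the identification of its source interface and the
lo-set of the first cell: the identity iposet of the cell for a path without steps, and the
gluing composition of the iposets of the steps in general. -/
noncomputable def Path.evAux {Λ : Type u} {X : IpcSet.{u, w} Λ} {x y : X.Cell} :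
    Path X x y → (P : Iposet Λ) × x.1.SrcIso P
  | .nil x => ⟨(x.1.withInterfaces Set.univ Set.univ).toIposet, x.1.univIso⟩
  | .cons s p =>
    ⟨s.ev.glue p.evAux.1 (s.tgtIso.trans p.evAux.2),
      s.srcIso.trans (s.ev.glueSrcIso p.evAux.1 (s.tgtIso.trans p.evAux.2))⟩

/-- The ipomset of a path. -/
noncomputable def Path.ev {Λ : Type u} {X : IpcSet.{u, w} Λ} {x y : X.Cell} (p : Path X x y) :
    Ipomset Λ :=
  Ipomset.mk p.evAux.1

/-- The set of ipomsets of the accepting paths. -/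
def Automaton.Lang {Λ : Type u} (X : Automaton.{u, w} Λ) : Set (Ipomset Λ) :=
  {P | ∃ x ∈ X.start, ∃ y ∈ X.accept, ∃ p : Path X.toIpc x y, P = p.ev}

/-- Regular languages: those recognised by an HDA or by an iHDA. -/
def IsRegular {Λ : Type u} (L : Set (Ipomset Λ)) : Prop :=
  ∃ X : Automaton.{u, w} Λ, (X.IsHDA ∨ X.IsIHDA) ∧ X.Lang = L

end HigherDim

namespace HigherDim

open CategoryTheory

/-! Two facts have to be reconciled. Rational operations close under subsumption, whereas the
language of an automaton is given by paths only. A realization bridges the gap. It assigns to each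
consistent state of the events of `P` (each event unstarted, active or terminated) a cell of `X`
whose events are the active ones, in such a way that unstarting or terminating active events
corresponds to taking faces. The sets `σ` and `τ` record the events that the interfaces of the cells
forbid to unstart or to terminate.

Realizations behave well in three respects. They pass from an ipomset to any ipomset subsumed by it
(`Realization.of_subsumed`), because more precedence leaves fewer consistent states. They compose
along gluing (`Realization.glue`). And if `P` is an interval ipomset, a realization unfolds into a
path with ipomset `P` (`Realization.exists_path`): some event can always be started or terminated
next, and doing so leaves a smaller realization. Steps and identities are realized by the faces of a
single cell (`Realization.of_cell`).

Hence the languages of interval ipomsets realized between two cells are closed under gluing with its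
down-closure, and each of their members comes from a path. Kleene's construction
(`exists_rational_closed`) then runs inside them. Adding one cell at a time, it builds rational
languages that consist of realized ipomsets and absorb steps on the left. When all cells have been
added, these languages contain all paths (`Path.ev_mem`) and nothing else. The construction uses
only half of the associativity of gluing on languages (`langGlue_langGlue_subset`), for which
interval ipomsets must be closed under gluing. The basic languages are discrete ipomsets of steps,
which are parallel compositions of single events (`IsRational.discrete`). -/

/-! ### Marked cells and their faces. -/

/-- The state of an event with respect to a cell. -/
inductive Status
  | unstarted
  | active
  | terminated

/-- A cell with its events named in `V`. -/
abbrev Marked {Λ : Type u} (X : IpcSet.{u, w} Λ) (V : Type) := Σ x : X.Cell, (Fin x.1.n → V)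

/-- Renaming of events. -/
def Marked.map {Λ : Type u} {X : IpcSet.{u, w} Λ} {V W : Type} (f : V → W) (m : Marked X V) :
    Marked X W := ⟨m.1, fun i => f (m.2 i)⟩

/-- `m` is the face of `m'` in which exactly the events of `m'` with unstarted status have been
unstarted and exactly the events with terminated status have been terminated. -/
def Face {Λ : Type u} {X : IpcSet.{u, w} Λ} {V : Type} (c : V → Status) (m m' : Marked X V) :
    Prop :=
  ∃ φ : m.1.1 ⟶ m'.1.1, (∀ i, m'.2 (φ.toFun i) = m.2 i) ∧
    φ.A = {i | c (m'.2 i) = Status.unstarted} ∧ φ.B = {i | c (m'.2 i) = Status.terminated} ∧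
    X.map φ.op m'.1.2 = m.1.2

/-- The state `c` arises from the state `c'` by unstarting or terminating active events. -/
def SubState {V : Type} (c c' : V → Status) : Prop := ∀ p, c' p ≠ Status.active → c p = c' p

theorem ILoSet.Hom.mem_range_iff {Λ : Type u} {U V : ILoSet Λ} (φ : U.Hom V) (i : Fin V.n) :
    i ∈ Set.range φ.toFun ↔ i ∉ φ.A ∧ i ∉ φ.B := by
  have := Set.ext_iff.mp φ.union_eq i
  simp only [Set.mem_union, Set.mem_compl_iff] at this
  tauto

/-- The category is skeletal: `A` and `B` determine the range, hence the number of events of the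
domain and the increasing map onto the range. Labels and interfaces of the domain are pulled back
along it. -/
theorem ILoSet.Hom.dom_unique {Λ : Type u} {U U' V : ILoSet Λ} (φ : U.Hom V) (ψ : U'.Hom V)
    (hA : φ.A = ψ.A) (hB : φ.B = ψ.B) : ∃ h : U = U', h ▸ φ = ψ := by
  have hr : Set.range φ.toFun = Set.range ψ.toFun := by
    ext i; rw [φ.mem_range_iff, ψ.mem_range_iff, hA, hB]
  obtain ⟨n, l, s, t⟩ := U
  obtain ⟨n', l', s', t'⟩ := U'
  have hn : n = n' := by
    have h1 := Set.ncard_range_of_injective φ.strictMono.injective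
    have h2 := Set.ncard_range_of_injective ψ.strictMono.injective
    rw [hr, h2] at h1
    simpa using h1.symm
  subst hn
  have hf : φ.toFun = ψ.toFun := (StrictMono.range_inj φ.strictMono ψ.strictMono).1 hr
  have hl : l = l' := funext fun i => by
    have h1 := φ.label_eq i
    have h2 := ψ.label_eq i
    rw [hf] at h1
    exact h1.symm.trans h2
  have hs : s = s' := Set.ext fun i => by
    have h1 := φ.src_iff i
    have h2 := ψ.src_iff i
    rw [hf] at h1
    exact h1.symm.trans h2
  have ht : t = t' := Set.ext fun i => by
    have h1 := φ.tgt_iff i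
    have h2 := ψ.tgt_iff i
    rw [hf] at h1
    exact h1.symm.trans h2
  subst hl hs ht
  exact ⟨rfl, ILoSet.Hom.ext hf hA hB⟩

theorem Face.unique {Λ : Type u} {X : IpcSet.{u, w} Λ} {V : Type} {c : V → Status}
    {m₁ m₂ m' : Marked X V} (h₁ : Face c m₁ m') (h₂ : Face c m₂ m') : m₁ = m₂ := by
  obtain ⟨φ, h, hA, hB, hX⟩ := h₁
  obtain ⟨ψ, k, kA, kB, kX⟩ := h₂
  obtain ⟨e, he⟩ := ILoSet.Hom.dom_unique φ ψ (hA.trans kA.symm) (hB.trans kB.symm)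
  obtain ⟨⟨U, x⟩, g⟩ := m₁
  obtain ⟨⟨U', x'⟩, g'⟩ := m₂
  dsimp only at e φ ψ
  subst e
  dsimp only at he
  subst he
  obtain rfl : x = x' := hX.symm.trans kX
  obtain rfl : g = g' := funext fun i => (h i).symm.trans (k i)
  rfl

theorem Face.map {Λ : Type u} {X : IpcSet.{u, w} Λ} {V W : Type} (f : V → W) {c : W → Status}
    {m m' : Marked X V} (h : Face (fun v => c (f v)) m m') : Face c (m.map f) (m'.map f) := by
  obtain ⟨φ, h, hA, hB, hX⟩ := h
  exact ⟨φ, fun i => congrArg f (h i), hA, hB, hX⟩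

theorem Face.comp {Λ : Type u} {X : IpcSet.{u, w} Λ} {V : Type} {c c' : V → Status}
    {m m' m'' : Marked X V} (hc : SubState c c') (h : Face c m m') (k : Face c' m' m'') :
    Face c m m'' := by
  obtain ⟨φ, h, hA, hB, hX⟩ := h
  obtain ⟨ψ, k, kA, kB, kX⟩ := k
  have key : ∀ i, i ∈ Set.range ψ.toFun ↔ c' (m''.2 i) = Status.active := by
    intro i
    rw [ψ.mem_range_iff, kA, kB, Set.mem_ofPred_eq, Set.mem_ofPred_eq]
    cases c' (m''.2 i) <;> simp
  -- An event with status `s` under `c` either has it already under `c'`, or is active under `c'`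
  -- and acquires it in the second face. This matches the formula for the sets `A` and `B` of a
  -- composite.
  have fib : ∀ s ≠ Status.active, ψ.toFun '' {j | c (m'.2 j) = s} ∪ {i | c' (m''.2 i) = s} =
      {i | c (m''.2 i) = s} := by
    intro s hs
    ext i
    constructor
    · rintro (⟨j, hj, rfl⟩ | hi)
      · rw [Set.mem_ofPred_eq, k]; exact hj
      · rw [Set.mem_ofPred_eq] at hi ⊢
        exact (hc _ (by rwa [hi])).trans hi
    · intro hi
      by_cases ha : c' (m''.2 i) = Status.active
      · obtain ⟨j, rfl⟩ := (key i).2 ha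
        exact Or.inl ⟨j, by rw [Set.mem_ofPred_eq, k] at hi; exact hi, rfl⟩
      · exact Or.inr ((hc _ ha).symm.trans hi)
  refine ⟨φ ≫ ψ, fun i => (k _).trans (h i), ?_, ?_, ?_⟩
  · change ψ.toFun '' φ.A ∪ ψ.A = _
    rw [hA, kA, fib _ Status.noConfusion]
  · change ψ.toFun '' φ.B ∪ ψ.B = _
    rw [hB, kB, fib _ Status.noConfusion]
  · have := X.map_comp ψ.op φ.op
    rw [op_comp, this, ← hX, ← kX]
    rfl

theorem Face.exists {Λ : Type u} {X : IpcSet.{u, w} Λ} {V : Type} (c : V → Status)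
    (m' : Marked X V) (hs : ∀ i ∈ m'.1.1.src, c (m'.2 i) ≠ Status.unstarted)
    (ht : ∀ i ∈ m'.1.1.tgt, c (m'.2 i) ≠ Status.terminated) : ∃ m, Face c m m' := by
  classical
  let s : Finset (Fin m'.1.1.n) := Finset.univ.filter fun i => c (m'.2 i) = Status.active
  let e := s.orderEmbOfFin rfl
  have he : Set.range e = {i | c (m'.2 i) = Status.active} := by
    simp [e, Finset.range_orderEmbOfFin, s]
  let U : ILoSet Λ := ⟨s.card, fun i => m'.1.1.label (e i), e ⁻¹' m'.1.1.src, e ⁻¹' m'.1.1.tgt⟩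
  let φ : U ⟶ m'.1.1 :=
    { toFun := e
      A := {i | c (m'.2 i) = Status.unstarted}
      B := {i | c (m'.2 i) = Status.terminated}
      strictMono := e.strictMono
      label_eq := fun _ => rfl
      src_iff := fun _ => Iff.rfl
      tgt_iff := fun _ => Iff.rfl
      union_eq := by
        rw [he]
        ext i
        simp only [Set.mem_union, Set.mem_ofPred_eq, Set.mem_compl_iff]
        cases c (m'.2 i) <;> simp
      disj := by
        rw [Set.disjoint_left]
        intro i hi hi'
        rw [Set.mem_ofPred_eq] at hi hi'
        rw [hi] at hi'
        exact Status.noConfusion hi'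
      A_src := Set.disjoint_left.2 fun i hi h => hs i h hi
      B_tgt := Set.disjoint_left.2 fun i hi h => ht i h hi }
  exact ⟨⟨⟨U, X.map φ.op m'.1.2⟩, fun i => m'.2 (e i)⟩, φ, fun _ => rfl, rfl, rfl, rfl⟩

/-- The face of `m'` in state `c` exists, since the interfaces of `m'` are pulled back from those of
`m''`. It is also a face of `m''` in state `c`, hence equals `m` by uniqueness. -/
theorem Face.factor {Λ : Type u} {X : IpcSet.{u, w} Λ} {V : Type} {c c' : V → Status}
    {m m' m'' : Marked X V} (hc : SubState c c') (h : Face c m m'') (k : Face c' m' m'') :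
    Face c m m' := by
  obtain ⟨n, hn⟩ : ∃ n, Face c n m' := by
    obtain ⟨φ, h, hA, hB, hX⟩ := h
    obtain ⟨ψ, k, kA, kB, kX⟩ := k
    apply Face.exists
    · intro i hi hu
      refine Set.disjoint_left.1 φ.A_src ?_ ((ψ.src_iff i).2 hi)
      rw [hA, Set.mem_ofPred_eq, k, hu]
    · intro i hi hu
      refine Set.disjoint_left.1 φ.B_tgt ?_ ((ψ.tgt_iff i).2 hi)
      rw [hB, Set.mem_ofPred_eq, k, hu]
  exact h.unique (hn.comp hc k) ▸ hn

/-! ### Consistent states and realizations. -/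

/-- Two increasing enumerations of the same set differ by a strictly increasing self-map of `Fin n`,
which is the identity. Consequently an equality of cells, with the same set of event names, extends
to an equality of marked cells. -/
theorem enum_unique {V : Type} {r : V → V → Prop} (hirr : ∀ x, ¬ r x x)
    (htr : ∀ x y z, r x y → r y z → r x z) {n : ℕ} {g g' : Fin n → V}
    (hg : ∀ i j, i < j → r (g i) (g j)) (hg' : ∀ i j, i < j → r (g' i) (g' j))
    (hr : ∀ p, (∃ i, g i = p) ↔ ∃ i, g' i = p) : g = g' := by
  choose h hh using fun i => (hr (g i)).1 ⟨i, rfl⟩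
  have hinj : ∀ i j, g i = g j → i = j := by
    intro i j e
    rcases lt_trichotomy i j with l | l | l
    · exact absurd (e ▸ hg i j l) (hirr _)
    · exact l
    · exact absurd (e ▸ hg j i l) (hirr _)
  have hmono : StrictMono h := by
    intro i j hij
    by_contra hlt
    have h1 := hg i j hij
    rw [← hh i, ← hh j] at h1
    rcases eq_or_lt_of_le (not_lt.1 hlt) with e | e
    · exact hirr _ (e ▸ h1)
    · exact hirr _ (htr _ _ _ h1 (hg' _ _ e))
  have hid : h = id := by
    refine (StrictMono.range_inj hmono strictMono_id).1 ?_
    rw [Set.range_id]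
    exact Set.range_eq_univ.2 (Finite.injective_iff_surjective.1 hmono.injective)
  funext i
  rw [← hh i, hid, id]

/-- The events of the marked cell `m` are the active events of the state `c` of `P`, in event
order; `σ` and `τ` are the interfaces. -/
structure Marked.Over {Λ : Type u} {X : IpcSet.{u, w} Λ} (P : Iposet Λ) (σ τ : Set P.carrier)
    (c : P.carrier → Status) (m : Marked X P.carrier) : Prop where
  mono : ∀ i j, i < j → P.ev (m.2 i) (m.2 j)
  range : ∀ p, (∃ i, m.2 i = p) ↔ c p = Status.active
  label : ∀ i, P.label (m.2 i) = m.1.1.label i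
  src : ∀ i, i ∈ m.1.1.src ↔ m.2 i ∈ σ
  tgt : ∀ i, i ∈ m.1.1.tgt ↔ m.2 i ∈ τ

theorem Marked.eq_of_enum {Λ : Type u} {X : IpcSet.{u, w} Λ} {V : Type} {r : V → V → Prop}
    (hirr : ∀ x, ¬ r x x) (htr : ∀ x y z, r x y → r y z → r x z) {m m' : Marked X V}
    (hx : m.1 = m'.1) (hm : ∀ i j, i < j → r (m.2 i) (m.2 j))
    (hm' : ∀ i j, i < j → r (m'.2 i) (m'.2 j))
    (hr : ∀ p, (∃ i, m.2 i = p) ↔ ∃ i, m'.2 i = p) : m = m' := by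
  obtain ⟨x, g⟩ := m
  obtain ⟨x', g'⟩ := m'
  dsimp only at hx
  subst hx
  obtain rfl : g = g' := enum_unique hirr htr hm hm' hr
  rfl

theorem Marked.Over.of_face {Λ : Type u} {X : IpcSet.{u, w} Λ} {P : Iposet Λ}
    {σ τ : Set P.carrier} {c c' : P.carrier → Status} {m m' : Marked X P.carrier}
    (h : m'.Over P σ τ c') (hf : Face c m m') (hc : SubState c c') : m.Over P σ τ c := by
  obtain ⟨φ, hφ, hA, hB, -⟩ := hf
  refine ⟨fun i j hij => ?_, fun p => ⟨?_, fun hp => ?_⟩, fun i => ?_, fun i => ?_, fun i => ?_⟩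
  · rw [← hφ, ← hφ]
    exact h.mono _ _ (φ.strictMono hij)
  · rintro ⟨i, rfl⟩
    have := (φ.mem_range_iff (φ.toFun i)).1 ⟨i, rfl⟩
    rw [hA, hB, Set.mem_ofPred_eq, Set.mem_ofPred_eq, hφ] at this
    cases hs : c (m.2 i) <;> simp_all
  · have hp' : c' p = Status.active := by
      by_contra hn
      exact hn ((hc p hn).symm.trans hp)
    obtain ⟨j, rfl⟩ := (h.range p).2 hp'
    obtain ⟨i, rfl⟩ := (φ.mem_range_iff j).2 (by
      rw [hA, hB, Set.mem_ofPred_eq, Set.mem_ofPred_eq, hp]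
      exact ⟨Status.noConfusion, Status.noConfusion⟩)
    exact ⟨i, (hφ i).symm⟩
  · rw [← hφ, h.label, φ.label_eq]
  · rw [← hφ, ← h.src, φ.src_iff]
  · rw [← hφ, ← h.tgt, φ.tgt_iff]

/-- The states of the events of `P` that may occur together. -/
structure Iposet.Consistent {Λ : Type u} (P : Iposet Λ) (σ τ : Set P.carrier)
    (c : P.carrier → Status) : Prop where
  prec : ∀ p q, P.lt p q → c q ≠ Status.unstarted → c p = Status.terminated
  src : ∀ p ∈ σ, c p ≠ Status.unstarted
  tgt : ∀ p ∈ τ, c p ≠ Status.terminated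

open Classical in
/-- The state in which exactly the source events have been started. -/
noncomputable def Iposet.initial {Λ : Type u} (P : Iposet Λ) (p : P.carrier) : Status :=
  if p ∈ P.S then Status.active else Status.unstarted

open Classical in
/-- The state in which all events but the target events have been terminated. -/
noncomputable def Iposet.final {Λ : Type u} (P : Iposet Λ) (p : P.carrier) : Status :=
  if p ∈ P.T then Status.active else Status.terminated

theorem Iposet.initial_eq_active {Λ : Type u} (P : Iposet Λ) (p : P.carrier) :
    P.initial p = Status.active ↔ p ∈ P.S := by
  by_cases h : p ∈ P.S <;> simp [Iposet.initial, h]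

theorem Iposet.final_eq_active {Λ : Type u} (P : Iposet Λ) (p : P.carrier) :
    P.final p = Status.active ↔ p ∈ P.T := by
  by_cases h : p ∈ P.T <;> simp [Iposet.final, h]

theorem Iposet.initial_of_notMem {Λ : Type u} (P : Iposet Λ) {p : P.carrier} (h : p ∉ P.S) :
    P.initial p = Status.unstarted := by simp [Iposet.initial, h]

theorem Iposet.final_of_notMem {Λ : Type u} (P : Iposet Λ) {p : P.carrier} (h : p ∉ P.T) :
    P.final p = Status.terminated := by simp [Iposet.final, h]

theorem Iposet.initial_eq_unstarted {Λ : Type u} (P : Iposet Λ) (p : P.carrier) :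
    P.initial p = Status.unstarted ↔ p ∉ P.S := by
  by_cases h : p ∈ P.S <;> simp [Iposet.initial, h]

theorem Iposet.final_eq_terminated {Λ : Type u} (P : Iposet Λ) (p : P.carrier) :
    P.final p = Status.terminated ↔ p ∉ P.T := by
  by_cases h : p ∈ P.T <;> simp [Iposet.final, h]

theorem Iposet.initial_ne_terminated {Λ : Type u} (P : Iposet Λ) (p : P.carrier) :
    P.initial p ≠ Status.terminated := by
  by_cases h : p ∈ P.S <;> simp [Iposet.initial, h]

theorem Iposet.final_ne_unstarted {Λ : Type u} (P : Iposet Λ) (p : P.carrier) :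
    P.final p ≠ Status.unstarted := by
  by_cases h : p ∈ P.T <;> simp [Iposet.final, h]

theorem Iposet.initial_consistent {Λ : Type u} (P : Iposet Λ) {σ τ : Set P.carrier}
    (hσ : σ ⊆ P.S) : P.Consistent σ τ P.initial := by
  refine ⟨fun p q h hq => ?_, fun p hp => ?_, fun p _ => ?_⟩
  · by_cases hS : q ∈ P.S
    · exact absurd h (P.S_minimal q hS p)
    · exact absurd (P.initial_of_notMem hS) hq
  · rw [(P.initial_eq_active p).2 (hσ hp)]; exact Status.noConfusion
  · exact P.initial_ne_terminated p

theorem Iposet.final_consistent {Λ : Type u} (P : Iposet Λ) {σ τ : Set P.carrier}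
    (hτ : τ ⊆ P.T) : P.Consistent σ τ P.final := by
  refine ⟨fun p q h hq => ?_, fun p _ => ?_, fun p hp => ?_⟩
  · by_cases hT : p ∈ P.T
    · exact absurd h (P.T_maximal p hT q)
    · exact P.final_of_notMem hT
  · exact P.final_ne_unstarted p
  · rw [(P.final_eq_active p).2 (hτ hp)]; exact Status.noConfusion

/-- A realization of `P` in `X` from `x` to `y`: a compatible family of cells, one for each
consistent state of the events of `P`. -/
structure Realization {Λ : Type u} (X : IpcSet.{u, w} Λ) (P : Iposet Λ) (x y : X.Cell) where
  σ : Set P.carrier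
  τ : Set P.carrier
  σ_sub : σ ⊆ P.S
  τ_sub : τ ⊆ P.T
  cell : (P.carrier → Status) → Marked X P.carrier
  marks : ∀ c, P.Consistent σ τ c → (cell c).Over P σ τ c
  face : ∀ c c', P.Consistent σ τ c → P.Consistent σ τ c' → SubState c c' →
    Face c (cell c) (cell c')
  init : (cell P.initial).1 = x
  fin : (cell P.final).1 = y

/-- Concurrent elements are comparable in the event order, so a map that preserves this order on
them cannot fail to reflect it. -/
theorem Iposet.IsSubsumption.ev_iff {Λ : Type u} {P Q : Iposet Λ} {f : P.carrier ≃ Q.carrier}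
    (hf : P.IsSubsumption Q f) {x y : P.carrier} (h₁ : ¬ P.lt x y) (h₂ : ¬ P.lt y x) :
    Q.ev (f x) (f y) ↔ P.ev x y := by
  refine ⟨fun h => ?_, fun h => hf.preserves x y h h₁ h₂⟩
  rcases P.comparable x y with e | e | e | e | e
  · rw [e] at h
    exact absurd h (Q.ev_irrefl _)
  · exact absurd e h₁
  · exact absurd e h₂
  · exact e
  · exact absurd (Q.ev_trans _ _ _ h (hf.preserves _ _ e h₂ h₁)) (Q.ev_irrefl _)

/-- Realizations are inherited along subsumptions. -/
theorem Realization.of_subsumed {Λ : Type u} {X : IpcSet.{u, w} Λ} {P Q : Iposet Λ}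
    {x y : X.Cell} (R : Realization X Q x y) (h : P.Subsumed Q) :
    Nonempty (Realization X P x y) := by
  classical
  obtain ⟨f, hf⟩ := h
  -- Precedence in `Q` is precedence in `P` already, so every consistent state of `P` is one of `Q`
  -- after renaming.
  have hcons : ∀ c, P.Consistent (f ⁻¹' R.σ) (f ⁻¹' R.τ) c →
      Q.Consistent R.σ R.τ fun q => c (f.symm q) := by
    intro c hc
    refine ⟨fun p q h hq => ?_, fun p hp => ?_, fun p hp => ?_⟩
    · exact hc.prec _ _ (hf.reflects _ _ (by simpa using h)) hq
    · exact hc.src _ (by simpa using hp)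
    · exact hc.tgt _ (by simpa using hp)
  refine ⟨⟨f ⁻¹' R.σ, f ⁻¹' R.τ, fun p hp => (hf.S_iff p).1 (R.σ_sub hp),
    fun p hp => (hf.T_iff p).1 (R.τ_sub hp),
    fun c => (R.cell fun q => c (f.symm q)).map f.symm, fun c hc => ?_,
    fun c c' hc hc' hs => ?_, ?_, ?_⟩⟩
  · have ho := R.marks _ (hcons c hc)
    have hact : ∀ i, c (f.symm ((R.cell fun q => c (f.symm q)).2 i)) = Status.active :=
      fun i => (ho.range _).1 ⟨i, rfl⟩
    -- Two active events are concurrent: an event that precedes a started one must be terminated.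
    have hconc : ∀ i j, ¬ P.lt (f.symm ((R.cell fun q => c (f.symm q)).2 i))
        (f.symm ((R.cell fun q => c (f.symm q)).2 j)) := by
      intro i j hlt
      have := hc.prec _ _ hlt (by rw [hact]; exact Status.noConfusion)
      rw [hact] at this
      exact Status.noConfusion this
    refine ⟨fun i j hij => ?_, fun p => ?_, fun i => ?_, fun i => ?_, fun i => ?_⟩
    · have hev := ho.mono i j hij
      change P.ev (f.symm _) (f.symm _)
      refine (hf.ev_iff (hconc i j) (hconc j i)).1 ?_
      rw [f.apply_symm_apply, f.apply_symm_apply]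
      exact hev
    · have := ho.range (f p)
      simp only [Equiv.symm_apply_apply] at this
      rw [← this]
      exact exists_congr fun i => f.symm_apply_eq
    · change P.label (f.symm _) = _
      rw [← hf.label_eq, Equiv.apply_symm_apply]
      exact ho.label i
    · refine (ho.src i).trans ?_
      change _ ↔ f (f.symm _) ∈ R.σ
      rw [Equiv.apply_symm_apply]
    · refine (ho.tgt i).trans ?_
      change _ ↔ f (f.symm _) ∈ R.τ
      rw [Equiv.apply_symm_apply]
  · apply Face.map
    have := R.face _ _ (hcons c hc) (hcons c' hc') fun q hq => hs _ hq
    obtain ⟨φ, h1, hA, hB, hX⟩ := this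
    exact ⟨φ, h1, hA, hB, hX⟩
  · have : (fun q => P.initial (f.symm q)) = Q.initial := by
      funext q
      have := hf.S_iff (f.symm q)
      simp only [Equiv.apply_symm_apply] at this
      exact if_congr this.symm rfl rfl
    rw [this]
    exact R.init
  · have : (fun q => P.final (f.symm q)) = Q.final := by
      funext q
      have := hf.T_iff (f.symm q)
      simp only [Equiv.apply_symm_apply] at this
      exact if_congr this.symm rfl rfl
    rw [this]
    exact R.fin

/-- A cell realizes its events, with any interfaces for which the faces are defined. -/
theorem Realization.of_cell {Λ : Type u} {X : IpcSet.{u, w} Λ} (u x y : X.Cell)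
    (S T : Set (Fin u.1.n)) (φ : x.1 ⟶ u.1) (hφA : φ.A = Sᶜ) (hφB : φ.B = ∅)
    (hφ : X.map φ.op u.2 = x.2) (ψ : y.1 ⟶ u.1) (hψA : ψ.A = ∅) (hψB : ψ.B = Tᶜ)
    (hψ : X.map ψ.op u.2 = y.2) :
    Nonempty (Realization X (u.1.withInterfaces S T).toIposet x y) := by
  classical
  let m : Marked X (Fin u.1.n) := ⟨u, fun i => i⟩
  -- Consistency with the interfaces of `u` is exactly what the existence of a face requires. At
  -- other states the value is arbitrary.
  have hex : ∀ c : Fin u.1.n → Status, ∃ m',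
      (u.1.withInterfaces S T).toIposet.Consistent u.1.src u.1.tgt c → Face c m' m := by
    intro c
    by_cases hc : (u.1.withInterfaces S T).toIposet.Consistent u.1.src u.1.tgt c
    · obtain ⟨m', hm'⟩ := Face.exists c m hc.src hc.tgt
      exact ⟨m', fun _ => hm'⟩
    · exact ⟨m, fun h => absurd h hc⟩
  choose F hF using hex
  have hσ : u.1.src ⊆ S := by
    intro i hi
    by_contra hn
    exact Set.disjoint_left.1 φ.A_src (by rw [hφA]; exact hn) hi
  have hτ : u.1.tgt ⊆ T := by
    intro i hi
    by_contra hn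
    exact Set.disjoint_left.1 ψ.B_tgt (by rw [hψB]; exact hn) hi
  have hm : m.Over (u.1.withInterfaces S T).toIposet u.1.src u.1.tgt fun _ => Status.active :=
    ⟨fun i j h => h, fun p => ⟨fun _ => rfl, fun _ => ⟨p, rfl⟩⟩, fun _ => rfl, fun _ => Iff.rfl,
      fun _ => Iff.rfl⟩
  refine ⟨⟨u.1.src, u.1.tgt, hσ, hτ, F, fun c hc => ?_, fun c c' hc hc' hs => ?_, ?_, ?_⟩⟩
  · exact hm.of_face (hF c hc) fun p hp => absurd rfl hp
  · exact (hF c hc).factor hs (hF c' hc')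
  · have h1 := hF _ (Iposet.initial_consistent (u.1.withInterfaces S T).toIposet hσ)
    have h2 : Face (u.1.withInterfaces S T).toIposet.initial ⟨x, φ.toFun⟩ m := by
      refine ⟨φ, fun _ => rfl, ?_, ?_, hφ⟩
      · rw [hφA]
        ext i
        exact (Iposet.initial_eq_unstarted (u.1.withInterfaces S T).toIposet i).symm
      · rw [hφB]
        ext i
        exact iff_of_false id (Iposet.initial_ne_terminated (u.1.withInterfaces S T).toIposet i)
    rw [h1.unique h2]
  · have h1 := hF _ (Iposet.final_consistent (u.1.withInterfaces S T).toIposet hτ)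
    have h2 : Face (u.1.withInterfaces S T).toIposet.final ⟨y, ψ.toFun⟩ m := by
      refine ⟨ψ, fun _ => rfl, ?_, ?_, hψ⟩
      · rw [hψA]
        ext i
        exact iff_of_false id (Iposet.final_ne_unstarted (u.1.withInterfaces S T).toIposet i)
      · rw [hψB]
        ext i
        exact (Iposet.final_eq_terminated (u.1.withInterfaces S T).toIposet i).symm
    rw [h1.unique h2]

theorem Iposet.glueInr_injective {Λ : Type u} (P Q : Iposet Λ) (f : P.Matching Q) :
    Function.Injective (P.glueInr Q f) := by
  intro x y h
  rcases P.glueInr_cases Q f x with ⟨t, rfl, ex⟩ | ⟨hx, ex⟩ <;>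
    rcases P.glueInr_cases Q f y with ⟨s, rfl, ey⟩ | ⟨hy, ey⟩ <;> rw [ex, ey] at h
  · rw [Subtype.ext (Sum.inl_injective h)]
  · cases h
  · cases h
  · exact congrArg Subtype.val (Sum.inr_injective h)

theorem Iposet.glueInr_eq_inl {Λ : Type u} (P Q : Iposet Λ) (f : P.Matching Q) {p : P.carrier}
    {q : Q.carrier} (h : P.glueInr Q f q = Sum.inl p) : p ∈ P.T ∧ q ∈ Q.S := by
  rcases P.glueInr_cases Q f q with ⟨t, rfl, ex⟩ | ⟨hx, ex⟩ <;> rw [ex] at h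
  · exact ⟨Sum.inl_injective h ▸ t.2, (f.1 t).2⟩
  · cases h

theorem Iposet.glue_cases {Λ : Type u} (P Q : Iposet Λ) (f : P.Matching Q)
    (a : (P.glue Q f).carrier) :
    (∃ p, a = Sum.inl p) ∨ ∃ q, q ∉ Q.S ∧ a = P.glueInr Q f q := by
  rcases a with p | q
  · exact Or.inl ⟨p, rfl⟩
  · exact Or.inr ⟨q.1, q.2, (P.glueInr_notMem Q f q.1 q.2).symm⟩

theorem Iposet.exists_glueInr {Λ : Type u} (P Q : Iposet Λ) (f : P.Matching Q) {p : P.carrier}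
    (hp : p ∈ P.T) : ∃ q ∈ Q.S, P.glueInr Q f q = Sum.inl p :=
  ⟨f.1 ⟨p, hp⟩, (f.1 ⟨p, hp⟩).2, P.glueInr_mem Q f ⟨p, hp⟩⟩

/-- Realizations compose. -/
theorem Realization.glue {Λ : Type u} {X : IpcSet.{u, w} Λ} {P Q : Iposet Λ} {x y z : X.Cell}
    (R₁ : Realization X P x z) (R₂ : Realization X Q z y) (f : P.Matching Q) :
    Nonempty (Realization X (P.glue Q f) x y) := by
  classical
  have o₁ := R₁.marks _ (P.final_consistent R₁.τ_sub)
  have o₂ := R₂.marks _ (Q.initial_consistent R₂.σ_sub)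
  have evl : ∀ a b, P.ev a b → (P.glue Q f).ev (Sum.inl a) (Sum.inl b) := fun a b h =>
    Relation.TransGen.single (Iposet.GlueEvBase.left a b h)
  have evr : ∀ a b, Q.ev a b → (P.glue Q f).ev (P.glueInr Q f a) (P.glueInr Q f b) :=
    fun a b h => Relation.TransGen.single (Iposet.GlueEvBase.right a b h)
  -- The two realizations meet in `z`: the final events of `P` and the initial events of `Q` are the
  -- same events of the gluing, enumerated in the same order.
  have hm : (R₁.cell P.final).map (W := (P.glue Q f).carrier) Sum.inl =
      (R₂.cell Q.initial).map (P.glueInr Q f) := by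
    refine Marked.eq_of_enum (P.glue Q f).ev_irrefl (P.glue Q f).ev_trans
      (R₁.fin.trans R₂.init.symm) (fun i j h => evl _ _ (o₁.mono i j h))
      (fun i j h => evr _ _ (o₂.mono i j h)) fun a => ⟨?_, ?_⟩
    · rintro ⟨i, rfl⟩
      obtain ⟨q, hq, e⟩ := P.exists_glueInr Q f
        ((P.final_eq_active _).1 ((o₁.range _).1 ⟨i, rfl⟩))
      obtain ⟨j, rfl⟩ := (o₂.range q).2 ((Q.initial_eq_active q).2 hq)
      exact ⟨j, e⟩
    · rintro ⟨i, rfl⟩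
      have hq := (Q.initial_eq_active _).1 ((o₂.range _).1 ⟨i, rfl⟩)
      rcases P.glueInr_cases Q f ((R₂.cell Q.initial).2 i) with ⟨t, -, ex⟩ | ⟨hn, -⟩
      · obtain ⟨j, hj⟩ := (o₁.range t.1).2 ((P.final_eq_active _).2 t.2)
        exact ⟨j, (congrArg Sum.inl hj).trans ex.symm⟩
      · exact absurd hq hn
  -- Both sides describe the interface of the shared cell `z`, read off through the two markings.
  have hσ : ∀ q, q ∈ R₂.σ ↔ P.glueInr Q f q ∈ Sum.inl '' R₁.σ := by
    have hs := congrArg (fun m : Marked X (P.glue Q f).carrier => m.2 '' m.1.1.src) hm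
    have key := fun a => Set.ext_iff.1 hs a
    intro q
    constructor
    · intro hq
      obtain ⟨i, rfl⟩ := (o₂.range q).2 ((Q.initial_eq_active q).2 (R₂.σ_sub hq))
      obtain ⟨j, hj, e⟩ := (key (P.glueInr Q f ((R₂.cell Q.initial).2 i))).2
        ⟨i, (o₂.src i).2 hq, rfl⟩
      exact ⟨_, (o₁.src j).1 hj, e⟩
    · rintro ⟨p, hp, e⟩
      obtain ⟨j, hj⟩ := (o₁.range p).2 ((P.final_eq_active _).2 (P.glueInr_eq_inl Q f e.symm).1)
      obtain ⟨i, hi, e'⟩ := (key (Sum.inl p)).1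
        ⟨j, (o₁.src j).2 (hj ▸ hp), congrArg Sum.inl hj⟩
      rw [← P.glueInr_injective Q f (e'.trans e)]
      exact (o₂.src i).1 hi
  have hτ : ∀ p, p ∈ R₁.τ ↔ (Sum.inl p : P.GlueCarrier Q) ∈ P.glueInr Q f '' R₂.τ := by
    have hs := congrArg (fun m : Marked X (P.glue Q f).carrier => m.2 '' m.1.1.tgt) hm
    have key := fun a => Set.ext_iff.1 hs a
    intro p
    constructor
    · intro hp
      obtain ⟨i, rfl⟩ := (o₁.range p).2 ((P.final_eq_active p).2 (R₁.τ_sub hp))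
      obtain ⟨j, hj, e⟩ := (key (Sum.inl ((R₁.cell P.final).2 i))).1
        ⟨i, (o₁.tgt i).2 hp, rfl⟩
      exact ⟨_, (o₂.tgt j).1 hj, e⟩
    · rintro ⟨q, hq, e⟩
      obtain ⟨j, hj⟩ := (o₂.range q).2 ((Q.initial_eq_active _).2 (P.glueInr_eq_inl Q f e).2)
      obtain ⟨i, hi, e'⟩ := (key (P.glueInr Q f q)).2
        ⟨j, (o₂.tgt j).2 (hj ▸ hq), congrArg (P.glueInr Q f) hj⟩
      rw [← Sum.inl_injective (e'.trans e)]
      exact (o₁.tgt i).1 hi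
  have hP : ∀ c, (P.glue Q f).Consistent (Sum.inl '' R₁.σ) (P.glueInr Q f '' R₂.τ) c →
      P.Consistent R₁.σ R₁.τ fun p => c (Sum.inl p) := fun c hc =>
    ⟨fun p q h hq => hc.prec _ _ (Iposet.GlueLt.left p q h) hq,
      fun p hp => hc.src _ ⟨p, hp, rfl⟩, fun p hp => hc.tgt _ ((hτ p).1 hp)⟩
  have hQ : ∀ c, (P.glue Q f).Consistent (Sum.inl '' R₁.σ) (P.glueInr Q f '' R₂.τ) c →
      Q.Consistent R₂.σ R₂.τ fun q => c (P.glueInr Q f q) := fun c hc =>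
    ⟨fun p q h hq => hc.prec _ _ (Iposet.GlueLt.right p q h) hq,
      fun q hq => hc.src _ ((hσ q).1 hq), fun q hq => hc.tgt _ ⟨q, hq, rfl⟩⟩
  -- A state is early if nothing of `Q` outside its source interface has started. Otherwise the
  -- precedences across the gluing force every event of `P` outside its target interface to be
  -- terminated. Early states use the first realization, the others the second.
  let early : ((P.glue Q f).carrier → Status) → Prop := fun c =>
    ∀ q, q ∉ Q.S → c (P.glueInr Q f q) = Status.unstarted
  let cell : ((P.glue Q f).carrier → Status) → Marked X (P.glue Q f).carrier := fun c =>
    if early c then (R₁.cell fun p => c (Sum.inl p)).map Sum.inl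
    else (R₂.cell fun q => c (P.glueInr Q f q)).map (P.glueInr Q f)
  have late_of : ∀ c, (P.glue Q f).Consistent (Sum.inl '' R₁.σ) (P.glueInr Q f '' R₂.τ) c →
      ¬ early c → ∀ p, p ∉ P.T → c (Sum.inl p) = Status.terminated := by
    intro c hc he p hp
    simp only [early, not_forall] at he
    obtain ⟨q, hq, hne⟩ := he
    exact hc.prec _ _ (Iposet.GlueLt.cross p q hp hq) hne
  have cell_early : ∀ c, early c → cell c = (R₁.cell fun p => c (Sum.inl p)).map Sum.inl :=
    fun c he => if_pos he
  have cell_late : ∀ c, (P.glue Q f).Consistent (Sum.inl '' R₁.σ) (P.glueInr Q f '' R₂.τ) c →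
      (∀ p, p ∉ P.T → c (Sum.inl p) = Status.terminated) →
      cell c = (R₂.cell fun q => c (P.glueInr Q f q)).map (P.glueInr Q f) := by
    intro c hc hl
    by_cases he : early c
    · rw [cell_early c he]
      -- Both descriptions apply here, and both cells are the face in state `c` of the shared cell
      -- `z`, so they agree.
      have h₁ := Face.map (W := (P.glue Q f).carrier) (c := c) Sum.inl
        (R₁.face _ _ (hP c hc) (P.final_consistent R₁.τ_sub) fun p hp => by
          have hp : p ∉ P.T := fun h => hp ((P.final_eq_active p).2 h)
          rw [P.final_of_notMem hp, hl p hp])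
      have h₂ := Face.map (W := (P.glue Q f).carrier) (c := c) (P.glueInr Q f)
        (R₂.face _ _ (hQ c hc) (Q.initial_consistent R₂.σ_sub) fun q hq => by
          have hq : q ∉ Q.S := fun h => hq ((Q.initial_eq_active q).2 h)
          rw [Q.initial_of_notMem hq, he q hq])
      rw [hm] at h₁
      exact h₁.unique h₂
    · exact if_neg he
  refine ⟨⟨Sum.inl '' R₁.σ, P.glueInr Q f '' R₂.τ, Set.image_mono R₁.σ_sub,
    Set.image_mono R₂.τ_sub, cell, fun c hc => ?_, fun c c' hc hc' hs => ?_, ?_, ?_⟩⟩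
  · by_cases he : early c
    · rw [cell_early c he]
      have ho := R₁.marks _ (hP c hc)
      refine ⟨fun i j h => evl _ _ (ho.mono i j h), fun a => ?_, ho.label, fun i => ?_,
        fun i => (ho.tgt i).trans (hτ _)⟩
      · rcases P.glue_cases Q f a with ⟨p, rfl⟩ | ⟨q, hq, rfl⟩
        · rw [← ho.range p]
          exact exists_congr fun i => Sum.inl_injective.eq_iff
        · rw [he q hq]
          refine iff_of_false ?_ Status.noConfusion
          rintro ⟨i, hi⟩
          exact hq (P.glueInr_eq_inl Q f hi.symm).2
      · refine (ho.src i).trans ?_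
        exact (Sum.inl_injective.mem_set_image).symm
    · have hl := late_of c hc he
      rw [cell_late c hc hl]
      have ho := R₂.marks _ (hQ c hc)
      have range_iff : ∀ q, (∃ i, P.glueInr Q f ((R₂.cell fun q => c (P.glueInr Q f q)).2 i) =
          P.glueInr Q f q) ↔ c (P.glueInr Q f q) = Status.active := by
        intro q
        rw [← ho.range q]
        exact exists_congr fun i => (P.glueInr_injective Q f).eq_iff
      refine ⟨fun i j h => evr _ _ (ho.mono i j h), fun a => ?_, fun i => ?_,
        fun i => (ho.src i).trans (hσ _), fun i => ?_⟩
      · rcases P.glue_cases Q f a with ⟨p, rfl⟩ | ⟨q, hq, rfl⟩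
        · by_cases hp : p ∈ P.T
          · obtain ⟨q, -, e⟩ := P.exists_glueInr Q f hp
            rw [← e]
            exact range_iff q
          · rw [hl p hp]
            refine iff_of_false ?_ Status.noConfusion
            rintro ⟨i, hi⟩
            exact hp (P.glueInr_eq_inl Q f hi).1
        · exact range_iff q
      · rw [show ((R₂.cell fun q => c (P.glueInr Q f q)).map (P.glueInr Q f)).1.1.label i = _ from
          (ho.label i).symm]
        change Sum.elim P.label (fun y => Q.label y.1) (P.glueInr Q f _) = _
        rcases P.glueInr_cases Q f ((R₂.cell fun q => c (P.glueInr Q f q)).2 i) with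
          ⟨t, e, ex⟩ | ⟨hn, ex⟩ <;> rw [ex]
        · rw [e]
          exact (f.2 t).symm
        · rfl
      · refine (ho.tgt i).trans ?_
        exact ((P.glueInr_injective Q f).mem_set_image).symm
  · by_cases he' : early c'
    · have he : early c := fun q hq => by
        rw [← he' q hq]
        exact hs _ (by rw [he' q hq]; exact Status.noConfusion)
      rw [cell_early c he, cell_early c' he']
      exact Face.map Sum.inl (R₁.face _ _ (hP c hc) (hP c' hc') fun p hp => hs _ hp)
    -- Lateness passes down to `c`, which may nevertheless be early as well. `cell_late` then lets
    -- the second realization serve for both states.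
    · have hl' := late_of c' hc' he'
      have hl : ∀ p, p ∉ P.T → c (Sum.inl p) = Status.terminated := fun p hp => by
        rw [← hl' p hp]
        exact hs _ (by rw [hl' p hp]; exact Status.noConfusion)
      rw [cell_late c hc hl, cell_late c' hc' hl']
      exact Face.map _ (R₂.face _ _ (hQ c hc) (hQ c' hc') fun p hp => hs _ hp)
  · rw [cell_early]
    · have : (fun p => (P.glue Q f).initial (Sum.inl p)) = P.initial := funext fun p =>
        if_congr Sum.inl_injective.mem_set_image rfl rfl
      rw [this]
      exact R₁.init
    · intro q hq
      apply Iposet.initial_of_notMem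
      rintro ⟨p, -, e⟩
      exact hq (P.glueInr_eq_inl Q f e.symm).2
  · rw [cell_late]
    · have : (fun q => (P.glue Q f).final (P.glueInr Q f q)) = Q.final := funext fun p =>
        if_congr (P.glueInr_injective Q f).mem_set_image rfl rfl
      rw [this]
      exact R₂.fin
    · exact Iposet.final_consistent _ (Set.image_mono R₂.τ_sub)
    · intro p hp
      apply Iposet.final_of_notMem
      rintro ⟨q, -, e⟩
      exact hp (P.glueInr_eq_inl Q f e).1

/-! ### Gluing composition: monotonicity, associativity, intervals. -/

/-- A finite strict total order is a well-order, and initial segment embeddings of well-orders are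
unique. -/
theorem LoIso.eq_of_total {Λ : Type u} {α β : Type} [Finite α] {r : α → α → Prop} {l : α → Λ}
    {s : β → β → Prop} {m : β → Λ} (hirr : ∀ x, ¬ r x x)
    (htr : ∀ x y z, r x y → r y z → r x z) (htri : ∀ x y, ¬ r x y → ¬ r y x → x = y)
    (f g : LoIso r l s m) (x : α) : f.1 x = g.1 x := by
  have : Std.Irrefl r := ⟨hirr⟩
  have : IsTrans α r := ⟨htr⟩
  have : IsWellFounded α r := ⟨Finite.wellFounded_of_trans_of_irrefl r⟩
  have : Std.Irrefl s := ⟨fun y h => hirr (f.1.symm y) ((f.1.symm.map_rel_iff).2 h)⟩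
  have : Std.Trichotomous s := ⟨fun a b h k => f.1.symm.injective
    (htri _ _ (fun h' => h (f.1.symm.map_rel_iff.1 h')) fun h' => k (f.1.symm.map_rel_iff.1 h'))⟩
  have h : f.1.toInitialSeg = g.1.toInitialSeg := Subsingleton.elim _ _
  exact DFunLike.congr_fun h x

/-- Elements of `T` are maximal, hence pairwise concurrent, so the event order on `T` is total. It
follows that a gluing composition does not depend on the matching. -/
theorem Iposet.Matching.unique {Λ : Type u} {P Q : Iposet Λ} (f g : P.Matching Q) (t : P.T) :
    f.1 t = g.1 t := by
  have := P.finite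
  refine LoIso.eq_of_total (r := fun x y : P.T => P.ev x y) (fun x => P.ev_irrefl x)
    (fun x y z => P.ev_trans x y z) (fun x y h k => ?_) f g t
  rcases P.comparable x y with e | e | e | e | e
  · exact Subtype.ext e
  · exact absurd e (P.T_maximal _ x.2 _)
  · exact absurd e (P.T_maximal _ y.2 _)
  · exact absurd e h
  · exact absurd e k

theorem Iposet.glueInr_label {Λ : Type u} (P Q : Iposet Λ) (f : P.Matching Q) (q : Q.carrier) :
    (P.glue Q f).label (P.glueInr Q f q) = Q.label q := by
  change Sum.elim P.label (fun y => Q.label y.1) (P.glueInr Q f q) = _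
  rcases P.glueInr_cases Q f q with ⟨t, e, ex⟩ | ⟨hn, ex⟩ <;> rw [ex]
  · rw [e]
    exact (f.2 t).symm
  · rfl

theorem Iposet.glueInr_lt {Λ : Type u} (P Q : Iposet Λ) (f : P.Matching Q) {q q' : Q.carrier} :
    (P.glue Q f).lt (P.glueInr Q f q) (P.glueInr Q f q') ↔ Q.lt q q' := by
  refine ⟨fun h => ?_, GlueLt.right q q'⟩
  have h : P.GlueLtCases Q f _ _ := (P.glueLt_iff Q f _ _).1 h
  rcases P.glueInr_cases Q f q with ⟨t, rfl, ex⟩ | ⟨hx, ex⟩ <;>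
    rcases P.glueInr_cases Q f q' with ⟨s, rfl, ey⟩ | ⟨hy, ey⟩ <;> rw [ex, ey] at h
  · exact absurd h (P.T_maximal _ t.2 _)
  · rcases h with h | ⟨s, hs, h⟩
    · exact absurd t.2 h
    · rw [Subtype.ext hs]
      exact h
  · exact h.elim
  · exact h

theorem Iposet.glueInr_ev {Λ : Type u} (P Q : Iposet Λ) (f : P.Matching Q) {q q' : Q.carrier} :
    (P.glue Q f).ev (P.glueInr Q f q) (P.glueInr Q f q') ↔ Q.ev q q' := by
  refine ⟨fun h => ?_, fun h => Relation.TransGen.single (GlueEvBase.right q q' h)⟩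
  have h := P.glueEv_cases Q f _ _ h
  rcases P.glueInr_cases Q f q with ⟨t, rfl, ex⟩ | ⟨hx, ex⟩ <;>
    rcases P.glueInr_cases Q f q' with ⟨s, rfl, ey⟩ | ⟨hy, ey⟩ <;> rw [ex, ey] at h
  · exact (f.ev_iff t s).2 h
  · obtain ⟨s, hs | hs, h⟩ := h
    · rw [Subtype.ext hs]
      exact h
    · exact Q.ev_trans _ _ _ ((f.ev_iff t s).2 hs) h
  · obtain ⟨t, h, hs | hs⟩ := h
    · rw [← Subtype.ext hs]
      exact h
    · exact Q.ev_trans _ _ _ h ((f.ev_iff t s).2 hs)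
  · exact h

/-- The event order of concurrent events of a gluing composition comes from one of the parts. -/
theorem Iposet.glue_ev_of_concurrent {Λ : Type u} (P Q : Iposet Λ) (f : P.Matching Q)
    {a b : (P.glue Q f).carrier} (h : (P.glue Q f).ev a b) (h₁ : ¬ (P.glue Q f).lt a b)
    (h₂ : ¬ (P.glue Q f).lt b a) :
    (∃ p p', a = Sum.inl p ∧ b = Sum.inl p' ∧ P.ev p p') ∨
      ∃ q q', a = P.glueInr Q f q ∧ b = P.glueInr Q f q' ∧ Q.ev q q' := by
  rcases P.glue_cases Q f a with ⟨p, rfl⟩ | ⟨q, hq, rfl⟩ <;>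
    rcases P.glue_cases Q f b with ⟨p', rfl⟩ | ⟨q', hq', rfl⟩
  · exact Or.inl ⟨p, p', rfl, rfl, P.glueEv_cases Q f _ _ h⟩
  · by_cases hp : p ∈ P.T
    · obtain ⟨q, -, e⟩ := P.exists_glueInr Q f hp
      rw [← e] at h ⊢
      exact Or.inr ⟨q, q', rfl, rfl, (P.glueInr_ev Q f).1 h⟩
    · exact absurd (GlueLt.cross p q' hp hq') h₁
  · by_cases hp : p' ∈ P.T
    · obtain ⟨q', -, e⟩ := P.exists_glueInr Q f hp
      rw [← e] at h ⊢
      exact Or.inr ⟨q, q', rfl, rfl, (P.glueInr_ev Q f).1 h⟩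
    · exact absurd (GlueLt.cross p' q hp hq) h₂
  · exact Or.inr ⟨q, q', rfl, rfl, (P.glueInr_ev Q f).1 h⟩

/-- `i` and `j` exhibit `G` as a set of events glued from `P` and `Q`, with at most the precedence
of the gluing composition. -/
structure Iposet.Covers {Λ : Type u} (P Q G : Iposet Λ) (f : P.Matching Q)
    (i : P.carrier → G.carrier) (j : Q.carrier → G.carrier) : Prop where
  inj_left : Function.Injective i
  inj_right : Function.Injective j
  glue : ∀ t, j (f.1 t) = i t.1
  disj : ∀ p q, q ∉ Q.S → i p ≠ j q
  surj : ∀ g, (∃ p, i p = g) ∨ ∃ q, q ∉ Q.S ∧ j q = g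
  label_left : ∀ p, G.label (i p) = P.label p
  label_right : ∀ q, G.label (j q) = Q.label q
  S_left : ∀ p, i p ∈ G.S ↔ p ∈ P.S
  S_right : ∀ q, q ∉ Q.S → j q ∉ G.S
  T_left : ∀ p, p ∉ P.T → i p ∉ G.T
  T_right : ∀ q, j q ∈ G.T ↔ q ∈ Q.T
  lt_left : ∀ p p', G.lt (i p) (i p') → P.lt p p'
  lt_right : ∀ q q', G.lt (j q) (j q') → Q.lt q q'
  lt_cross : ∀ p q, q ∉ Q.S → ¬ G.lt (j q) (i p)
  ev_left : ∀ p p', P.ev p p' → ¬ P.lt p p' → ¬ P.lt p' p → G.ev (i p) (i p')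
  ev_right : ∀ q q', Q.ev q q' → ¬ Q.lt q q' → ¬ Q.lt q' q → G.ev (j q) (j q')

/-- The values of the bijection on the two parts are recorded so that `Iposet.Covers.isomorphic` can
also check that precedence is preserved. -/
theorem Iposet.Covers.exists_subsumption {Λ : Type u} {P Q G : Iposet Λ} {f : P.Matching Q}
    {i : P.carrier → G.carrier} {j : Q.carrier → G.carrier} (h : P.Covers Q G f i j) :
    ∃ e : (P.glue Q f).carrier ≃ G.carrier, (P.glue Q f).IsSubsumption G e ∧
      (∀ p, e (Sum.inl p) = i p) ∧ ∀ q, e (P.glueInr Q f q) = j q := by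
  let e₀ : (P.glue Q f).carrier → G.carrier := Sum.elim i fun q => j q.1
  have bij : Function.Bijective e₀ := by
    constructor
    · rintro (p | q) (p' | q') e
      · exact congrArg Sum.inl (h.inj_left e)
      · exact absurd e (h.disj _ _ q'.2)
      · exact absurd e.symm (h.disj _ _ q.2)
      · exact congrArg Sum.inr (Subtype.ext (h.inj_right e))
    · intro g
      rcases h.surj g with ⟨p, hp⟩ | ⟨q, hq, hg⟩
      · exact ⟨Sum.inl p, hp⟩
      · exact ⟨Sum.inr ⟨q, hq⟩, hg⟩
  have el : ∀ p, Equiv.ofBijective e₀ bij (Sum.inl p) = i p := fun _ => rfl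
  have er : ∀ q, Equiv.ofBijective e₀ bij (P.glueInr Q f q) = j q := by
    intro q
    rcases P.glueInr_cases Q f q with ⟨t, rfl, ex⟩ | ⟨hn, ex⟩ <;> rw [ex]
    · exact (h.glue t).symm
    · rfl
  refine ⟨Equiv.ofBijective e₀ bij, ⟨fun a => ?_, fun a => ?_, fun a => ?_, fun a b hab => ?_,
    fun a b hab h₁ h₂ => ?_⟩, el, er⟩
  · rcases P.glue_cases Q f a with ⟨p, rfl⟩ | ⟨q, hq, rfl⟩
    · exact h.label_left p
    · rw [er, P.glueInr_label]
      exact h.label_right q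
  · rcases P.glue_cases Q f a with ⟨p, rfl⟩ | ⟨q, hq, rfl⟩
    · rw [el, h.S_left]
      exact Sum.inl_injective.mem_set_image.symm
    · rw [er]
      refine iff_of_false (h.S_right q hq) ?_
      rintro ⟨p, -, e⟩
      exact hq (P.glueInr_eq_inl Q f e.symm).2
  · have hr : ∀ q, j q ∈ G.T ↔ P.glueInr Q f q ∈ (P.glue Q f).T := fun q =>
      (h.T_right q).trans (P.glueInr_injective Q f).mem_set_image.symm
    rcases P.glue_cases Q f a with ⟨p, rfl⟩ | ⟨q, hq, rfl⟩
    · by_cases hp : p ∈ P.T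
      · obtain ⟨q, -, e⟩ := P.exists_glueInr Q f hp
        rw [← e, er]
        exact hr q
      · rw [el]
        refine iff_of_false (h.T_left p hp) ?_
        rintro ⟨q, -, e⟩
        exact hp (P.glueInr_eq_inl Q f e).1
    · rw [er]
      exact hr q
  · have hr : ∀ q q', G.lt (Equiv.ofBijective e₀ bij (P.glueInr Q f q))
        (Equiv.ofBijective e₀ bij (P.glueInr Q f q')) →
        (P.glue Q f).lt (P.glueInr Q f q) (P.glueInr Q f q') := fun q q' hq => by
      rw [er, er] at hq
      exact (P.glueInr_lt Q f).2 (h.lt_right _ _ hq)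
    rcases P.glue_cases Q f a with ⟨p, rfl⟩ | ⟨q, hq, rfl⟩ <;>
      rcases P.glue_cases Q f b with ⟨p', rfl⟩ | ⟨q', hq', rfl⟩
    · exact GlueLt.left _ _ (h.lt_left _ _ hab)
    · by_cases hp : p ∈ P.T
      · obtain ⟨q, -, e⟩ := P.exists_glueInr Q f hp
        rw [← e] at hab ⊢
        exact hr _ _ hab
      · exact GlueLt.cross p q' hp hq'
    · rw [er, el] at hab
      exact absurd hab (h.lt_cross _ _ hq)
    · exact hr _ _ hab
  · rcases P.glue_ev_of_concurrent Q f hab h₁ h₂ with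
      ⟨p, p', rfl, rfl, hev⟩ | ⟨q, q', rfl, rfl, hev⟩
    · exact h.ev_left _ _ hev (fun k => h₁ (GlueLt.left _ _ k)) fun k => h₂ (GlueLt.left _ _ k)
    · rw [er, er]
      exact h.ev_right _ _ hev (fun k => h₁ (GlueLt.right _ _ k))
        fun k => h₂ (GlueLt.right _ _ k)

theorem Iposet.Covers.subsumed {Λ : Type u} {P Q G : Iposet Λ} {f : P.Matching Q}
    {i : P.carrier → G.carrier} {j : Q.carrier → G.carrier} (h : P.Covers Q G f i j) :
    (P.glue Q f).Subsumed G :=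
  let ⟨e, he, _⟩ := h.exists_subsumption
  ⟨e, he⟩

theorem Iposet.Covers.isomorphic {Λ : Type u} {P Q G : Iposet Λ} {f : P.Matching Q}
    {i : P.carrier → G.carrier} {j : Q.carrier → G.carrier} (h : P.Covers Q G f i j)
    (hl : ∀ p p', P.lt p p' → G.lt (i p) (i p')) (hr : ∀ q q', Q.lt q q' → G.lt (j q) (j q'))
    (hc : ∀ p q, p ∉ P.T → q ∉ Q.S → G.lt (i p) (j q)) : (P.glue Q f).Isomorphic G := by
  obtain ⟨e, he, el, er⟩ := h.exists_subsumption
  refine ⟨e, he, fun a b => ⟨fun hab => ?_, he.reflects a b⟩⟩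
  rcases hab with ⟨p, p', k⟩ | ⟨q, q', k⟩ | ⟨p, q, hp, hq⟩
  · rw [el, el]; exact hl _ _ k
  · rw [er, er]; exact hr _ _ k
  · rw [el, er]; exact hc _ _ hp hq

/-- A subsumption identifies the source interfaces. -/
def Iposet.IsSubsumption.srcIso {Λ : Type u} {P Q : Iposet Λ} {f : P.carrier ≃ Q.carrier}
    (hf : P.IsSubsumption Q f) :
    LoIso (fun x y : P.S => P.ev x y) (fun x : P.S => P.label x)
      (fun x y : Q.S => Q.ev x y) (fun x : Q.S => Q.label x) :=
  ⟨⟨f.subtypeEquiv fun x => (hf.S_iff x).symm, fun {x y} =>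
    hf.ev_iff (P.S_minimal _ y.2 _) (P.S_minimal _ x.2 _)⟩, fun x => hf.label_eq x⟩

theorem Iposet.covers_of_subsumption {Λ : Type u} {P Q Q' : Iposet Λ} (f : P.Matching Q)
    (f' : P.Matching Q') {h : Q.carrier ≃ Q'.carrier} (hh : Q.IsSubsumption Q' h) :
    P.Covers Q (P.glue Q' f') f Sum.inl fun q => P.glueInr Q' f' (h q) where
  inj_left := Sum.inl_injective
  inj_right := (P.glueInr_injective Q' f').comp h.injective
  glue t := by
    have := Iposet.Matching.unique f' (LoIso.trans f hh.srcIso) t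
    rw [← P.glueInr_mem Q' f' t, this]
    rfl
  disj p q hq e := hq ((hh.S_iff q).1 (P.glueInr_eq_inl Q' f' e.symm).2)
  surj g := by
    rcases P.glue_cases Q' f' g with ⟨p, rfl⟩ | ⟨q, hq, rfl⟩
    · exact Or.inl ⟨p, rfl⟩
    · refine Or.inr ⟨h.symm q, fun hn => hq ?_, by rw [h.apply_symm_apply]⟩
      rw [← h.apply_symm_apply q]
      exact (hh.S_iff _).2 hn
  label_left _ := rfl
  label_right q := (P.glueInr_label Q' f' _).trans (hh.label_eq q)
  S_left _ := Sum.inl_injective.mem_set_image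
  S_right q hq := by
    rintro ⟨p, -, e⟩
    exact hq ((hh.S_iff q).1 (P.glueInr_eq_inl Q' f' e.symm).2)
  T_left p hp := by
    rintro ⟨q, -, e⟩
    exact hp (P.glueInr_eq_inl Q' f' e).1
  T_right q := (P.glueInr_injective Q' f').mem_set_image.trans (hh.T_iff q)
  lt_left p p' k := (P.glueLt_iff Q' f' _ _).1 k
  lt_right q q' k := hh.reflects _ _ ((P.glueInr_lt Q' f').1 k)
  lt_cross p q hq k := by
    rw [P.glueInr_notMem Q' f' _ fun hn => hq ((hh.S_iff q).1 hn)] at k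
    exact (P.glueLt_iff Q' f' _ _).1 k
  ev_left p p' k _ _ := Relation.TransGen.single (GlueEvBase.left p p' k)
  ev_right q q' k k₁ k₂ := (P.glueInr_ev Q' f').2 (hh.preserves q q' k k₁ k₂)

theorem Iposet.Subsumed.glue_right {Λ : Type u} {P Q Q' : Iposet Λ} (h : Q.Subsumed Q')
    (f : P.Matching Q) (f' : P.Matching Q') : (P.glue Q f).Subsumed (P.glue Q' f') :=
  let ⟨_, hk⟩ := h
  (Iposet.covers_of_subsumption f f' hk).subsumed

theorem Iposet.Isomorphic.glue_right {Λ : Type u} {P Q Q' : Iposet Λ} (h : Q.Isomorphic Q')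
    (f : P.Matching Q) (f' : P.Matching Q') : (P.glue Q f).Isomorphic (P.glue Q' f') := by
  obtain ⟨k, hk, hlt⟩ := h
  refine (Iposet.covers_of_subsumption f f' hk).isomorphic (fun p p' => GlueLt.left p p')
    (fun q q' hq => GlueLt.right _ _ ((hlt q q').1 hq)) fun p q hp hq => GlueLt.cross _ _ hp ?_
  exact fun hn => hq ((hk.S_iff q).1 hn)

/-- The target interface of a gluing composition. -/
noncomputable def Iposet.glueTgtIso {Λ : Type u} (P Q : Iposet Λ) (f : P.Matching Q) :
    LoIso (fun x y : Q.T => Q.ev x y) (fun x : Q.T => Q.label x)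
      (fun x y : (P.glue Q f).T => (P.glue Q f).ev x y)
      (fun x : (P.glue Q f).T => (P.glue Q f).label x) :=
  ⟨⟨Equiv.Set.image (P.glueInr Q f) Q.T (P.glueInr_injective Q f), fun {_ _} =>
    P.glueInr_ev Q f⟩, fun x => P.glueInr_label Q f x⟩

/-- This half of associativity suffices for Kleene's construction. The matchings of the other
bracketing are obtained by transporting `f` and `g` along the identifications of the interfaces. -/
theorem Iposet.glue_assoc_subsumed {Λ : Type u} (P Q R : Iposet Λ) (g : Q.Matching R)
    (f : P.Matching (Q.glue R g)) :
    ∃ (f' : P.Matching Q) (g' : (P.glue Q f').Matching R),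
      (P.glue (Q.glue R g) f).Subsumed ((P.glue Q f').glue R g') := by
  let f' : P.Matching Q := LoIso.trans f (Q.glueSrcIso R g).symm
  let g' : (P.glue Q f').Matching R := LoIso.trans (P.glueTgtIso Q f').symm g
  have hf' : ∀ t, (f.1 t).1 = Sum.inl (f'.1 t).1 := fun t =>
    congrArg Subtype.val ((Q.glueSrcIso R g).1.apply_symm_apply (f.1 t)).symm
  have hg' : ∀ t : Q.T, g'.1 ⟨P.glueInr Q f' t.1, t.1, t.2, rfl⟩ = g.1 t := fun t =>
    congrArg g.1 ((P.glueTgtIso Q f').1.symm_apply_apply t)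
  -- `J` includes `Q * R` into `(P * Q) * R`; events of `Q` may be identified with target events of
  -- `P`.
  let J : (Q.glue R g).carrier → ((P.glue Q f').glue R g').carrier :=
    Sum.elim (fun q => Sum.inl (P.glueInr Q f' q)) Sum.inr
  have hJ : ∀ r, J (Q.glueInr R g r) = (P.glue Q f').glueInr R g' r := by
    intro r
    rcases Q.glueInr_cases R g r with ⟨t, rfl, ex⟩ | ⟨hn, ex⟩ <;> rw [ex]
    · rw [← hg' t, Iposet.glueInr_mem]
      rfl
    · rw [Iposet.glueInr_notMem _ _ _ _ hn]
      rfl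
  have Jinj : Function.Injective J := by
    rintro (q | r) (q' | r') e
    · exact congrArg Sum.inl (P.glueInr_injective Q f' (Sum.inl_injective e))
    · cases e
    · cases e
    · exact congrArg Sum.inr (Sum.inr_injective e)
  have Jinl : ∀ w p, J w = Sum.inl (Sum.inl p) → w ∈ (Q.glue R g).S := by
    rintro (q | r) p e
    · exact ⟨q, (P.glueInr_eq_inl Q f' (Sum.inl_injective e)).2, rfl⟩
    · cases e
  refine ⟨f', g', (show P.Covers (Q.glue R g) _ f (fun p => Sum.inl (Sum.inl p)) J from
    { inj_left := Sum.inl_injective.comp Sum.inl_injective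
      inj_right := Jinj
      glue := fun t => ?_
      disj := fun p w hw e => hw (Jinl w p e.symm)
      surj := ?_
      label_left := fun _ => rfl
      label_right := ?_
      S_left := fun p => ?_
      S_right := ?_
      T_left := ?_
      T_right := ?_
      lt_left := fun p p' k => ?_
      lt_right := ?_
      lt_cross := ?_
      ev_left := fun p p' k _ _ => ?_
      ev_right := ?_ }).subsumed⟩
  · rw [hf' t]
    exact congrArg Sum.inl (P.glueInr_mem Q f' t)
  · rintro ((p | q) | r)
    · exact Or.inl ⟨p, rfl⟩
    · refine Or.inr ⟨Sum.inl q.1, ?_, congrArg Sum.inl (P.glueInr_notMem Q f' q.1 q.2)⟩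
      rintro ⟨q', hq', e⟩
      exact q.2 (Sum.inl_injective e ▸ hq')
    · refine Or.inr ⟨Sum.inr r, ?_, rfl⟩
      rintro ⟨q', hq', e⟩
      cases e
  · rintro (q | r)
    · exact P.glueInr_label Q f' q
    · rfl
  · exact Sum.inl_injective.mem_set_image.trans Sum.inl_injective.mem_set_image
  · rintro w hw ⟨_, ⟨p, hp, rfl⟩, e⟩
    exact hw (Jinl w p e.symm)
  · rintro p hp ⟨r, hr, e⟩
    obtain ⟨q, -, e'⟩ := (Iposet.glueInr_eq_inl _ _ _ e).1
    exact hp (P.glueInr_eq_inl Q f' e').1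
  · intro w
    constructor
    · rintro ⟨r, hr, e⟩
      exact ⟨r, hr, Jinj ((hJ r).trans e)⟩
    · rintro ⟨r, hr, rfl⟩
      exact ⟨r, hr, (hJ r).symm⟩
  · exact (P.glueLt_iff Q f' _ _).1 ((Iposet.glueLt_iff _ _ _ _ _).1 k)
  · rintro (q | r) (q' | r') k <;> have k := (Iposet.glueLt_iff _ _ _ _ _).1 k
    · exact GlueLt.left _ _ ((P.glueInr_lt Q f').1 k)
    · refine (Iposet.glueLt_iff _ _ _ _ _).2 ?_
      rcases k with k | ⟨t, e, k⟩
      · exact Or.inl fun hq => k ⟨q, hq, rfl⟩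
      · obtain ⟨_, ⟨t, ht, rfl⟩⟩ := t
        obtain rfl := P.glueInr_injective Q f' e
        rw [hg' ⟨q, ht⟩] at k
        exact Or.inr ⟨⟨q, ht⟩, rfl, k⟩
    · exact k.elim
    · exact (Iposet.glueLt_iff _ _ _ _ _).2 k
  · rintro p (q | r) hw k <;> have k := (Iposet.glueLt_iff _ _ _ _ _).1 k
    · have hq : q ∉ Q.S := fun hq => hw ⟨q, hq, rfl⟩
      have k : (P.glue Q f').lt (P.glueInr Q f' q) (Sum.inl p) := k
      rw [P.glueInr_notMem Q f' q hq] at k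
      exact (P.glueLt_iff Q f' _ _).1 k
    · exact k
  · exact Relation.TransGen.single (GlueEvBase.left _ _
      (Relation.TransGen.single (GlueEvBase.left _ _ k)))
  · intro w w' k k₁ k₂
    rcases Q.glue_ev_of_concurrent R g k k₁ k₂ with ⟨q, q', rfl, rfl, h⟩ | ⟨r, r', rfl, rfl, h⟩
    · exact Relation.TransGen.single (GlueEvBase.left _ _ ((P.glueInr_ev Q f').2 h))
    · rw [hJ, hJ]
      exact (Iposet.glueInr_ev _ _ _).2 h

/-- Squeeze the representation of `P` into the negative reals and that of `Q` into the positive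
ones. An event shared by both begins where it does in `P` and ends where it does in `Q`. -/
theorem Iposet.IsInterval.glue {Λ : Type u} {P Q : Iposet Λ} (hP : P.IsInterval)
    (hQ : Q.IsInterval) (f : P.Matching Q) : (P.glue Q f).IsInterval := by
  classical
  obtain ⟨b, e, hbe, hlt⟩ := hP
  obtain ⟨b', e', hbe', hlt'⟩ := hQ
  -- A strictly increasing map to the negative reals.
  let n : ℝ → ℝ := fun x => -Real.exp (-x)
  have hn : ∀ x, n x < 0 := fun x => neg_lt_zero.2 (Real.exp_pos _)
  have nlt : ∀ {x y}, n x < n y ↔ x < y := by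
    intro x y
    simp [n]
  have pos := Real.exp_pos
  refine ⟨Sum.elim (fun p => n (b p)) fun q => Real.exp (b' q.1),
    Sum.elim (fun p => if h : p ∈ P.T then Real.exp (e' (f.1 ⟨p, h⟩)) else n (e p))
      fun q => Real.exp (e' q.1), ?_, ?_⟩
  · rintro (p | q)
    · by_cases h : p ∈ P.T
      · simp only [Sum.elim_inl, h, dite_true]
        exact ((hn _).trans (pos _)).le
      · simp only [Sum.elim_inl, h, dite_false]
        exact not_lt.1 fun k => absurd (nlt.1 k) (not_lt.2 (hbe p))
    · exact Real.exp_le_exp.2 (hbe' _)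
  · intro a c
    refine (P.glueLt_iff Q f a c).trans ?_
    rcases a with p | q <;> rcases c with p' | q'
    · simp only [Iposet.GlueLtCases, Sum.elim_inl]
      by_cases h : p ∈ P.T
      · simp only [h, dite_true]
        exact iff_of_false (P.T_maximal p h p') (not_lt.2 ((hn _).trans (pos _)).le)
      · simp only [h, dite_false]
        rw [nlt, hlt]
    · simp only [Iposet.GlueLtCases, Sum.elim_inl, Sum.elim_inr]
      by_cases h : p ∈ P.T
      · simp only [h, dite_true, not_true, false_or]
        rw [Real.exp_lt_exp, ← hlt']
        constructor
        · rintro ⟨t, rfl, k⟩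
          exact k
        · exact fun k => ⟨⟨p, h⟩, rfl, k⟩
      · simp only [h, dite_false, not_false_eq_true, true_or, true_iff]
        exact (hn _).trans (pos _)
    · simp only [Iposet.GlueLtCases, Sum.elim_inl, Sum.elim_inr, false_iff, not_lt]
      exact ((hn _).trans (pos _)).le
    · simp only [Iposet.GlueLtCases, Sum.elim_inr]
      rw [Real.exp_lt_exp, hlt']

/-! ### From realizations of interval iposets to paths. -/

theorem Face.of_map {Λ : Type u} {X : IpcSet.{u, w} Λ} {V W : Type} {f : V → W}
    (hf : Function.Injective f) {c : W → Status} {m m' : Marked X V}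
    (h : Face c (m.map f) (m'.map f)) : Face (fun v => c (f v)) m m' := by
  obtain ⟨φ, h, hA, hB, hX⟩ := h
  exact ⟨φ, fun i => hf (h i), hA, hB, hX⟩

theorem Marked.Over.injective {Λ : Type u} {X : IpcSet.{u, w} Λ} {P : Iposet Λ}
    {σ τ : Set P.carrier} {c : P.carrier → Status} {m : Marked X P.carrier}
    (h : m.Over P σ τ c) : Function.Injective m.2 := by
  intro i j e
  rcases lt_trichotomy i j with l | l | l
  · exact absurd (e ▸ h.mono i j l) (P.ev_irrefl _)
  · exact l
  · exact absurd (e ▸ h.mono j i l) (P.ev_irrefl _)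

/-- A matching of an ilo-set with an iposet, from an enumeration of the source interface. -/
noncomputable def ILoSet.matching {Λ : Type u} (V : ILoSet Λ) (Q : Iposet Λ) (g : V.tgt → Q.S)
    (hs : Function.Surjective g) (hm : ∀ i j : V.tgt, i.1 < j.1 → Q.ev (g i).1 (g j).1)
    (hl : ∀ i, Q.label (g i).1 = V.label i.1) : V.toIposet.Matching Q :=
  have mono : ∀ i j : V.tgt, Q.ev (g i).1 (g j).1 ↔ i.1 < j.1 := fun i j =>
    ⟨fun h => by
      rcases lt_trichotomy i.1 j.1 with l | l | l
      · exact l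
      · rw [Subtype.ext l] at h
        exact absurd h (Q.ev_irrefl _)
      · exact absurd (Q.ev_trans _ _ _ h (hm _ _ l)) (Q.ev_irrefl _), hm i j⟩
  have inj : Function.Injective g := fun i j e => by
    rcases lt_trichotomy i.1 j.1 with l | l | l
    · exact absurd (e ▸ hm i j l) (Q.ev_irrefl _)
    · exact Subtype.ext l
    · exact absurd (e ▸ hm j i l) (Q.ev_irrefl _)
  ⟨⟨Equiv.ofBijective g ⟨inj, hs⟩, fun {i j} => mono i j⟩, hl⟩

/-- Enlarging the source interface by a minimal event. -/
def Iposet.start {Λ : Type u} (P : Iposet Λ) (p : P.carrier) (hp : ∀ q, ¬ P.lt q p) :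
    Iposet Λ where
  __ := P
  S := insert p P.S
  S_minimal := by
    rintro q (rfl | hq)
    · exact hp
    · exact P.S_minimal q hq

/-- Removal of an event. -/
def Iposet.erase {Λ : Type u} (P : Iposet Λ) (s : P.carrier) : Iposet Λ where
  carrier := {q // q ≠ s}
  finite := by have := P.finite; infer_instance
  lt x y := P.lt x y
  ev x y := P.ev x y
  lt_irrefl x := P.lt_irrefl x
  lt_trans x y z := P.lt_trans x y z
  ev_irrefl x := P.ev_irrefl x
  ev_trans x y z := P.ev_trans x y z
  comparable x y := by rw [Subtype.ext_iff]; exact P.comparable x y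
  label x := P.label x
  S := Subtype.val ⁻¹' P.S
  T := Subtype.val ⁻¹' P.T
  S_minimal x hx y := P.S_minimal x hx y
  T_maximal x hx y := P.T_maximal x hx y

theorem Iposet.IsInterval.start {Λ : Type u} {P : Iposet Λ} (h : P.IsInterval) {p : P.carrier}
    (hp : ∀ q, ¬ P.lt q p) : (P.start p hp).IsInterval := h

theorem Iposet.IsInterval.erase {Λ : Type u} {P : Iposet Λ} (h : P.IsInterval) (s : P.carrier) :
    (P.erase s).IsInterval := by
  obtain ⟨b, e, hbe, hlt⟩ := h
  exact ⟨fun x => b x.1, fun x => e x.1, fun x => hbe x.1, fun x y => hlt x.1 y.1⟩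

/-- The number of starts and terminations of events outside of the source interface. -/
noncomputable def Iposet.size {Λ : Type u} (P : Iposet Λ) : ℕ :=
  Nat.card P.carrier + (P.Sᶜ).ncard

theorem Iposet.size_start_lt {Λ : Type u} (P : Iposet Λ) {p : P.carrier} (hp : ∀ q, ¬ P.lt q p)
    (hpS : p ∉ P.S) : (P.start p hp).size < P.size := by
  have := P.finite
  have hfin : (P.Sᶜ).Finite := Set.toFinite _
  refine Nat.add_lt_add_left (Set.ncard_lt_ncard ?_ hfin) _
  refine Set.ssubset_iff_exists.2 ⟨fun q hq h => hq (Or.inr h), p, hpS, fun h => h (Or.inl rfl)⟩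

theorem Iposet.size_erase_lt {Λ : Type u} (P : Iposet Λ) (s : P.carrier) :
    (P.erase s).size < P.size := by
  have := P.finite
  refine Nat.add_lt_add_of_lt_of_le ?_ ?_
  · exact Finite.card_subtype_lt (p := fun q => q ≠ s) (x := s) (by simp)
  · exact Set.ncard_le_ncard_of_injOn Subtype.val (fun x hx => hx)
      Subtype.val_injective.injOn (Set.toFinite _)

/-- The state in which `p` is active along with the source events is consistent, and the initial
cell is a face of its cell: this is the up-step. The same family of cells realizes `P.start p hp`,
since only the source interface, and so the initial state, has changed. -/
theorem Realization.exists_step_start {Λ : Type u} {X : IpcSet.{u, w} Λ} {P : Iposet Λ}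
    {x y : X.Cell} (R : Realization X P x y) {p : P.carrier} (hp : ∀ q, ¬ P.lt q p) :
    ∃ (z : X.Cell) (s : Step X x z) (f : s.ev.Matching (P.start p hp)),
      Nonempty (Realization X (P.start p hp) z y) ∧
      (s.ev.glue (P.start p hp) f).Isomorphic P := by
  obtain ⟨σ, τ, hσ, hτ, cell, marks, face, init, fin⟩ := R
  subst init
  have cons : P.Consistent σ τ (P.start p hp).initial :=
    let h := (P.start p hp).initial_consistent (σ := σ) (τ := τ) fun q hq => Or.inr (hσ hq)
    ⟨h.prec, h.src, h.tgt⟩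
  have act := (P.start p hp).initial_eq_active
  have ho := marks _ cons
  have hS : ∀ q, (∃ i, (cell (P.start p hp).initial).2 i = q) ↔ q ∈ (P.start p hp).S :=
    fun q => (ho.range q).trans (act q)
  obtain ⟨φ, hφ, hA, hB, hX⟩ := face _ _ (P.initial_consistent hσ) cons (fun q hq => by
    have hq : q ∉ (P.start p hp).S := fun h => hq ((act q).2 h)
    rw [P.initial_of_notMem fun h => hq (Or.inr h), (P.start p hp).initial_of_notMem hq])
  have hB' : φ.B = ∅ := by
    rw [hB]
    ext i
    exact iff_of_false (P.initial_ne_terminated _) id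
  let s : Step X (cell P.initial).1 (cell (P.start p hp).initial).1 := Step.up φ hB' hX
  let f : s.ev.Matching (P.start p hp) :=
    ILoSet.matching ((cell (P.start p hp).initial).1.1.withInterfaces φ.Aᶜ Set.univ) _
      (fun i => ⟨(cell (P.start p hp).initial).2 i.1, (hS _).1 ⟨i.1, rfl⟩⟩)
      (fun q => by
        obtain ⟨i, hi⟩ := (hS q.1).2 q.2
        exact ⟨⟨i, trivial⟩, Subtype.ext hi⟩)
      (fun i j h => ho.mono _ _ h) fun i => ho.label _
  have min : ∀ i q, ¬ P.lt q ((cell (P.start p hp).initial).2 i) := fun i q =>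
    (P.start p hp).S_minimal _ ((hS _).1 ⟨i, rfl⟩) q
  refine ⟨_, s, f, ⟨⟨σ, τ, fun q hq => Or.inr (hσ hq), hτ, cell, fun c hc => ?_,
    fun c c' hc hc' => face c c' ⟨hc.prec, hc.src, hc.tgt⟩ ⟨hc'.prec, hc'.src, hc'.tgt⟩, rfl,
    fin⟩⟩, ?_⟩
  · have h := marks c ⟨hc.prec, hc.src, hc.tgt⟩
    exact ⟨h.mono, h.range, h.label, h.src, h.tgt⟩
  · refine (show s.ev.Covers (P.start p hp) P f (cell (P.start p hp).initial).2 id from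
      { inj_left := ho.injective
        inj_right := Function.injective_id
        glue := fun t => rfl
        disj := fun i q hq e => hq ((hS q).1 ⟨i, e⟩)
        surj := fun q => ?_
        label_left := ho.label
        label_right := fun _ => rfl
        S_left := fun i => ?_
        S_right := fun q hq h => hq (Or.inr h)
        T_left := fun i hi => absurd trivial hi
        T_right := fun _ => Iff.rfl
        lt_left := fun i j h => absurd h (min _ _)
        lt_right := fun _ _ h => h
        lt_cross := fun i q _ => min _ _
        ev_left := fun i j h _ _ => ho.mono i j h
        ev_right := fun _ _ h _ _ => h }).isomorphic (fun _ _ h => h.elim) (fun _ _ h => h)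
        fun i _ hi => absurd trivial hi
    · by_cases hq : q ∈ (P.start p hp).S
      · exact Or.inl ((hS q).2 hq)
      · exact Or.inr ⟨q, hq, rfl⟩
    · change _ ↔ i ∈ φ.Aᶜ
      rw [hA]
      exact (not_iff_comm.1 (P.initial_eq_unstarted _).symm).symm

open Classical in
/-- The extension of a state by a terminated event. -/
noncomputable def Iposet.terminate {Λ : Type u} (P : Iposet Λ) (s : P.carrier)
    (c : (P.erase s).carrier → Status) (q : P.carrier) : Status :=
  if h : q = s then Status.terminated else c ⟨q, h⟩

theorem Iposet.terminate_val {Λ : Type u} (P : Iposet Λ) (s : P.carrier)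
    (c : (P.erase s).carrier → Status) (q : (P.erase s).carrier) :
    P.terminate s c q.1 = c q :=
  dif_neg q.2

theorem Iposet.terminate_self {Λ : Type u} (P : Iposet Λ) (s : P.carrier)
    (c : (P.erase s).carrier → Status) : P.terminate s c s = Status.terminated := by
  simp [Iposet.terminate]

/-- The cells at states with `s` terminated realize the rest of `P`, and the first of them is a
lower neighbour of the initial cell by a down-step. By `hlt`, gluing puts back exactly the
precedences of `s`. -/
theorem Realization.exists_step_erase {Λ : Type u} {X : IpcSet.{u, w} Λ} {P : Iposet Λ}
    {x y : X.Cell} (R : Realization X P x y) {s : P.carrier} (hsS : s ∈ P.S) (hsT : s ∉ P.T)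
    (hlt : ∀ q, q ∉ P.S → P.lt s q) :
    ∃ (z : X.Cell) (k : Step X x z) (f : k.ev.Matching (P.erase s)),
      Nonempty (Realization X (P.erase s) z y) ∧ (k.ev.glue (P.erase s) f).Isomorphic P := by
  classical
  obtain ⟨σ, τ, hσ, hτ, cell, marks, face, init, fin⟩ := R
  subst init
  have cons : ∀ c, (P.erase s).Consistent (Subtype.val ⁻¹' σ) (Subtype.val ⁻¹' τ) c →
      P.Consistent σ τ (P.terminate s c) := by
    intro c hc
    refine ⟨fun p q h hq => ?_, fun p hp => ?_, fun p hp => ?_⟩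
    · by_cases ep : p = s
      · rw [ep, P.terminate_self]
      · have eq : q ≠ s := fun e => P.S_minimal s hsS p (e ▸ h)
        rw [P.terminate_val s c ⟨q, eq⟩] at hq
        rw [P.terminate_val s c ⟨p, ep⟩]
        exact hc.prec ⟨p, ep⟩ ⟨q, eq⟩ h hq
    · by_cases ep : p = s
      · rw [ep, P.terminate_self]; exact Status.noConfusion
      · rw [P.terminate_val s c ⟨p, ep⟩]; exact hc.src ⟨p, ep⟩ hp
    · have ep : p ≠ s := fun e => hsT (hτ (e ▸ hp))
      rw [P.terminate_val s c ⟨p, ep⟩]; exact hc.tgt ⟨p, ep⟩ hp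
  have hσ' : Subtype.val ⁻¹' σ ⊆ (P.erase s).S := fun q hq => hσ hq
  have hτ' : Subtype.val ⁻¹' τ ⊆ (P.erase s).T := fun q hq => hτ hq
  have consI := (P.erase s).initial_consistent (τ := Subtype.val ⁻¹' τ) hσ'
  have lift : ∀ c, (P.erase s).Consistent (Subtype.val ⁻¹' σ) (Subtype.val ⁻¹' τ) c →
      ∃ m : Marked X (P.erase s).carrier, m.map Subtype.val = cell (P.terminate s c) := by
    intro c hc
    have ho := marks _ (cons c hc)
    refine ⟨⟨(cell (P.terminate s c)).1, fun i => ⟨(cell (P.terminate s c)).2 i, fun e => ?_⟩⟩, rfl⟩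
    have := (ho.range s).1 ⟨i, e⟩
    rw [P.terminate_self] at this
    exact Status.noConfusion this
  have lift' : ∀ c, ∃ m : Marked X (P.erase s).carrier,
      (P.erase s).Consistent (Subtype.val ⁻¹' σ) (Subtype.val ⁻¹' τ) c →
        m.map Subtype.val = cell (P.terminate s c) := by
    intro c
    by_cases hc : (P.erase s).Consistent (Subtype.val ⁻¹' σ) (Subtype.val ⁻¹' τ) c
    · obtain ⟨m, hm⟩ := lift c hc
      exact ⟨m, fun _ => hm⟩
    · obtain ⟨m, -⟩ := lift _ consI
      exact ⟨m, fun h => absurd h hc⟩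
  choose cell' hcell using lift'
  have ho := marks _ (P.initial_consistent (τ := τ) hσ)
  have hS : ∀ q, (∃ i, (cell P.initial).2 i = q) ↔ q ∈ P.S :=
    fun q => (ho.range q).trans (P.initial_eq_active q)
  obtain ⟨φ, hφ, hA, hB, hX⟩ := face _ _ (cons _ consI) (P.initial_consistent hσ) (fun q hq => by
    have hq : q ∉ P.S := fun h => hq ((P.initial_eq_active q).2 h)
    have e : q ≠ s := fun e => hq (e ▸ hsS)
    rw [P.initial_of_notMem hq, P.terminate_val s _ ⟨q, e⟩]
    exact (P.erase s).initial_of_notMem (p := ⟨q, e⟩) hq)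
  have hA' : φ.A = ∅ := by
    rw [hA]
    ext i
    refine iff_of_false (fun h => ?_) id
    rw [Set.mem_ofPred_eq] at h
    by_cases e : (cell P.initial).2 i = s
    · rw [e, P.terminate_self] at h
      exact Status.noConfusion h
    · rw [P.terminate_val s _ ⟨_, e⟩] at h
      exact ((P.erase s).initial_eq_unstarted _).1 h ((hS _).1 ⟨i, rfl⟩)
  -- The step terminates `s` and nothing else.
  have hB' : ∀ i, i ∉ φ.Bᶜ ↔ (cell P.initial).2 i = s := by
    intro i
    rw [hB, Set.mem_compl_iff, not_not, Set.mem_ofPred_eq]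
    constructor
    · intro h
      by_contra e
      rw [P.terminate_val s _ ⟨_, e⟩] at h
      exact (P.erase s).initial_ne_terminated _ h
    · intro e
      rw [e, P.terminate_self]
  let k : Step X (cell P.initial).1 (cell (P.terminate s (P.erase s).initial)).1 :=
    Step.down φ hA' hX
  let f : k.ev.Matching (P.erase s) :=
    ILoSet.matching ((cell P.initial).1.1.withInterfaces Set.univ φ.Bᶜ) (P.erase s)
      (fun i => ⟨⟨(cell P.initial).2 i.1, fun e => (hB' i.1).2 e i.2⟩, (hS _).1 ⟨i.1, rfl⟩⟩)
      (fun q => by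
        obtain ⟨i, hi⟩ := (hS q.1.1).2 q.2
        refine ⟨⟨i, ?_⟩, Subtype.ext (Subtype.ext hi)⟩
        by_contra h
        exact q.1.2 (hi.symm.trans ((hB' i).1 h)))
      (fun i j h => ho.mono _ _ h) fun i => ho.label _
  have min : ∀ i q, ¬ P.lt q ((cell P.initial).2 i) := fun i q =>
    P.S_minimal _ ((hS _).1 ⟨i, rfl⟩) q
  refine ⟨_, k, f, ⟨⟨Subtype.val ⁻¹' σ, Subtype.val ⁻¹' τ, hσ', hτ', cell', fun c hc => ?_,
    fun c c' hc hc' hs => ?_, ?_, ?_⟩⟩, ?_⟩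
  · have h := marks _ (cons c hc)
    rw [← hcell c hc] at h
    refine ⟨h.mono, fun q => ?_, h.label, h.src, h.tgt⟩
    rw [← P.terminate_val s c q, ← h.range]
    exact exists_congr fun i => Subtype.ext_iff
  · have h := face _ _ (cons c hc) (cons c' hc') (fun q hq => by
      by_cases e : q = s
      · rw [e, P.terminate_self, P.terminate_self]
      · rw [P.terminate_val s c' ⟨q, e⟩] at hq ⊢
        rw [P.terminate_val s c ⟨q, e⟩]
        exact hs _ hq)
    rw [← hcell c hc, ← hcell c' hc'] at h
    have h := h.of_map Subtype.val_injective
    exact (congrArg (fun d => Face d (cell' c) (cell' c'))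
      (funext (P.terminate_val s c))).mp h
  · exact congrArg Sigma.fst (hcell _ consI)
  · refine (congrArg Sigma.fst (hcell _ ((P.erase s).final_consistent hτ'))).trans ?_
    rw [← fin]
    congr 2
    funext q
    by_cases e : q = s
    · rw [e, P.terminate_self, P.final_of_notMem hsT]
    · rw [P.terminate_val s _ ⟨q, e⟩]
      rfl
  · refine (show k.ev.Covers (P.erase s) P f (cell P.initial).2 Subtype.val from
      { inj_left := ho.injective
        inj_right := Subtype.val_injective
        glue := fun t => rfl
        disj := fun i q hq e => hq ((hS q.1).1 ⟨i, e⟩)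
        surj := fun q => ?_
        label_left := ho.label
        label_right := fun _ => rfl
        S_left := fun i => iff_of_true ((hS _).1 ⟨i, rfl⟩) trivial
        S_right := fun q hq h => hq h
        T_left := fun i hi => by rw [(hB' i).1 hi]; exact hsT
        T_right := fun _ => Iff.rfl
        lt_left := fun i j h => absurd h (min _ _)
        lt_right := fun _ _ h => h
        lt_cross := fun i q _ => min _ _
        ev_left := fun i j h _ _ => ho.mono i j h
        ev_right := fun _ _ h _ _ => h }).isomorphic (fun _ _ h => h.elim) (fun _ _ h => h)
        fun i q hi hq => by rw [(hB' i).1 hi]; exact hlt _ hq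
    by_cases hq : q ∈ P.S
    · exact Or.inl ((hS q).2 hq)
    · exact Or.inr ⟨⟨q, fun e => hq (e ▸ hsS)⟩, hq, rfl⟩

theorem Realization.exists_path_of_univ {Λ : Type u} {X : IpcSet.{u, w} Λ} {P : Iposet Λ}
    {x y : X.Cell} (R : Realization X P x y) (hS : ∀ q, q ∈ P.S) (hT : ∀ q, q ∈ P.T) :
    ∃ p : Path X x y, P.Isomorphic p.evAux.1 := by
  obtain ⟨σ, τ, hσ, hτ, cell, marks, face, init, fin⟩ := R
  -- All events are active at both ends, so the two end cells coincide and the path has no steps.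
  have e : P.final = P.initial := by
    funext q
    rw [(P.initial_eq_active q).2 (hS q), (P.final_eq_active q).2 (hT q)]
  rw [e] at fin
  subst init fin
  have ho := marks _ (P.initial_consistent (τ := τ) hσ)
  refine ⟨Path.nil _, Iposet.Isomorphic.symm ⟨Equiv.ofBijective (cell P.initial).2
    ⟨ho.injective, fun q => (ho.range q).2 ((P.initial_eq_active q).2 (hS q))⟩,
    ⟨ho.label, fun i => iff_of_true (hS _) trivial, fun i => iff_of_true (hT _) trivial,
      fun i j h => absurd h (P.S_minimal _ (hS _) _), fun i j h _ _ => ho.mono i j h⟩,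
    fun i j => iff_of_false id (P.S_minimal _ (hS _) _)⟩⟩

/-- Realized interval iposets are the iposets of paths. -/
theorem Realization.exists_path {Λ : Type u} {X : IpcSet.{u, w} Λ} {P : Iposet Λ}
    {x y : X.Cell} (R : Realization X P x y) (hP : P.IsInterval) :
    ∃ p : Path X x y, P.Isomorphic p.evAux.1 := by
  induction hn : P.size using Nat.strong_induction_on generalizing P x with
  | _ n ih =>
  subst hn
  have cons : ∀ {z : X.Cell} (s : Step X x z) (P' : Iposet Λ) (f : s.ev.Matching P'),
      Nonempty (Realization X P' z y) → (s.ev.glue P' f).Isomorphic P → P'.size < P.size →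
      P'.IsInterval → ∃ p : Path X x y, P.Isomorphic p.evAux.1 := by
    rintro z s P' f ⟨R'⟩ hf hs hP'
    obtain ⟨p, hp⟩ := ih _ hs R' hP' rfl
    exact ⟨Path.cons s p, hf.symm.trans (hp.glue_right f _)⟩
  by_cases hmin : ∃ p, p ∉ P.S ∧ ∀ q, ¬ P.lt q p
  · obtain ⟨p, hpS, hp⟩ := hmin
    obtain ⟨z, s, f, hR, hf⟩ := R.exists_step_start hp
    exact cons s _ f hR hf (P.size_start_lt hp hpS) (hP.start hp)
  · push Not at hmin
    by_cases hall : (∀ q, q ∈ P.S) ∧ ∀ q, q ∈ P.T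
    · exact R.exists_path_of_univ hall.1 hall.2
    -- No new event can be started, so one has to be terminated. If events outside `S` remain, take
    -- an event `s` that ends first in an interval representation. Each event outside `S` has a
    -- predecessor, which ends no earlier than `s`; so `s` precedes all of them.
    · obtain ⟨s, hsS, hsT, hlt⟩ : ∃ s ∈ P.S, s ∉ P.T ∧ ∀ q, q ∉ P.S → P.lt s q := by
        by_cases hS : ∀ q, q ∈ P.S
        · obtain ⟨s, hs⟩ := not_forall.1 fun h => hall ⟨hS, h⟩
          exact ⟨s, hS s, hs, fun q hq => absurd (hS q) hq⟩
        · obtain ⟨r, hr⟩ := not_forall.1 hS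
          have := P.finite
          have : Nonempty P.carrier := ⟨r⟩
          obtain ⟨b, e, hbe, hlt⟩ := hP
          obtain ⟨s, hs⟩ := Finite.exists_min e
          have key : ∀ q, q ∉ P.S → P.lt s q := fun q hq => by
            obtain ⟨t, ht⟩ := hmin q hq
            exact (hlt s q).2 ((hs t).trans_lt ((hlt t q).1 ht))
          refine ⟨s, ?_, fun h => P.T_maximal s h r (key r hr), key⟩
          -- If `s` were outside `S`, it would precede itself.
          by_contra h
          exact P.lt_irrefl s (key s h)
      obtain ⟨z, k, f, hR, hf⟩ := R.exists_step_erase hsS hsT hlt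
      exact cons k _ f hR hf (P.size_erase_lt s) (hP.erase s)

/-! ### Rationality of discrete ipomsets and of finite languages. -/

theorem Iposet.Subsumed.refl {Λ : Type u} (P : Iposet Λ) : P.Subsumed P :=
  (Iposet.Isomorphic.refl P).subsumed

theorem Iposet.Subsumed.isomorphic_of_discrete {Λ : Type u} {P Q : Iposet Λ}
    (h : P.Subsumed Q) (hP : ∀ x y, ¬ P.lt x y) : P.Isomorphic Q :=
  let ⟨f, hf⟩ := h
  ⟨f, hf, fun x y => iff_of_false (hP x y) fun k => hP x y (hf.reflects x y k)⟩

theorem inl_mem_union_image {α β : Type} {A : Set α} {B : Set β} {a : α} :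
    (Sum.inl a : α ⊕ β) ∈ Sum.inl '' A ∪ Sum.inr '' B ↔ a ∈ A := by simp

theorem inr_mem_union_image {α β : Type} {A : Set α} {B : Set β} {b : β} :
    (Sum.inr b : α ⊕ β) ∈ Sum.inl '' A ∪ Sum.inr '' B ↔ b ∈ B := by simp

theorem Iposet.Subsumed.par {Λ : Type u} {P P' Q Q' : Iposet Λ} (h : P.Subsumed P')
    (k : Q.Subsumed Q') : (P.par Q).Subsumed (P'.par Q') := by
  obtain ⟨f, hf⟩ := h
  obtain ⟨g, hg⟩ := k
  refine ⟨Equiv.sumCongr f g, ⟨?_, ?_, ?_, ?_, ?_⟩⟩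
  · rintro (x | x)
    · exact hf.label_eq x
    · exact hg.label_eq x
  · rintro (x | x)
    · exact inl_mem_union_image.trans ((hf.S_iff x).trans inl_mem_union_image.symm)
    · exact inr_mem_union_image.trans ((hg.S_iff x).trans inr_mem_union_image.symm)
  · rintro (x | x)
    · exact inl_mem_union_image.trans ((hf.T_iff x).trans inl_mem_union_image.symm)
    · exact inr_mem_union_image.trans ((hg.T_iff x).trans inr_mem_union_image.symm)
  · rintro (x | x) (y | y) h
    · exact Sum.LiftRel.inl (hf.reflects x y (Sum.liftRel_inl_inl.1 h))
    · cases h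
    · cases h
    · exact Sum.LiftRel.inr (hg.reflects x y (Sum.liftRel_inr_inr.1 h))
  · rintro (x | x) (y | y) h h₁ h₂
    · exact Sum.Lex.inl (hf.preserves x y (Sum.lex_inl_inl.1 h)
        (fun k => h₁ (Sum.LiftRel.inl k)) fun k => h₂ (Sum.LiftRel.inl k))
    · exact Sum.Lex.sep _ _
    · cases h
    · exact Sum.Lex.inr (hg.preserves x y (Sum.lex_inr_inr.1 h)
        (fun k => h₁ (Sum.LiftRel.inr k)) fun k => h₂ (Sum.LiftRel.inr k))

theorem ILoSet.isInterval {Λ : Type u} (U : ILoSet Λ) : U.toIposet.IsInterval :=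
  ⟨fun _ => 0, fun _ => 0, fun _ => le_rfl, fun _ _ => iff_of_false id (lt_irrefl _)⟩

open Classical in
/-- Every nonempty ilo-set is the parallel composition of its first event and the others. -/
theorem ILoSet.par_isomorphic {Λ : Type u} {n : ℕ} (l : Fin (n + 1) → Λ)
    (S T : Set (Fin (n + 1))) :
    ((ILoSet.toIposet ⟨1, fun _ => l 0, {_i | decide (0 ∈ S) = true},
      {_i | decide (0 ∈ T) = true}⟩).par
      (ILoSet.toIposet ⟨n, fun i => l i.succ, Fin.succ ⁻¹' S, Fin.succ ⁻¹' T⟩)).Isomorphic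
      (ILoSet.toIposet ⟨n + 1, l, S, T⟩) := by
  have bij : Function.Bijective (Sum.elim (fun _ : Fin 1 => (0 : Fin (n + 1))) Fin.succ) := by
    constructor
    · rintro (i | i) (j | j) h
      · rw [Subsingleton.elim i j]
      · exact absurd h (Fin.succ_ne_zero j).symm
      · exact absurd h (Fin.succ_ne_zero i)
      · exact congrArg Sum.inr (Fin.succ_injective _ h)
    · intro i
      refine Fin.cases ⟨Sum.inl 0, rfl⟩ (fun j => ⟨Sum.inr j, rfl⟩) i
  refine ⟨Equiv.ofBijective _ bij, ⟨?_, ?_, ?_, fun _ _ h => h.elim, ?_⟩, ?_⟩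
  · rintro (i | i) <;> rfl
  · rintro (i | i)
    · refine Iff.trans ?_ inl_mem_union_image.symm
      exact (decide_eq_true_iff (p := (0 : Fin (n + 1)) ∈ S)).symm
    · refine Iff.trans ?_ inr_mem_union_image.symm
      exact Iff.rfl
  · rintro (i | i)
    · refine Iff.trans ?_ inl_mem_union_image.symm
      exact (decide_eq_true_iff (p := (0 : Fin (n + 1)) ∈ T)).symm
    · refine Iff.trans ?_ inr_mem_union_image.symm
      exact Iff.rfl
  · rintro (i | i) (j | j) h - -
    · exact absurd (Sum.lex_inl_inl.1 h) (not_lt.2 (Subsingleton.elim (α := Fin 1) j i).le)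
    · exact Fin.succ_pos j
    · cases h
    · exact Fin.succ_lt_succ_iff.2 (Sum.lex_inr_inr.1 h)
  · rintro a b
    refine iff_of_false ?_ id
    rintro (h | h) <;> exact h

/-- Parallel composition adds one event at a time. Its down-closure adds nothing, because minimality
of all events (or maximality of all) excludes precedence in a subsumed ipomset. This is why one
interface has to be full. -/
theorem IsRational.discrete {Λ : Type u} {n : ℕ} (l : Fin n → Λ) (S T : Set (Fin n))
    (h : S = Set.univ ∨ T = Set.univ) :
    IsRational {Ipomset.mk (ILoSet.toIposet ⟨n, l, S, T⟩)} := by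
  classical
  induction n with
  | zero =>
    have e : (⟨0, l, S, T⟩ : ILoSet Λ) = ⟨0, fun i => i.elim0, ∅, ∅⟩ := by
      congr 1
      · exact Subsingleton.elim _ _
      · exact Subsingleton.elim _ _
      · exact Subsingleton.elim _ _
    rw [e]
    exact IsRational.epsilon
  | succ n ih =>
    have hi := ILoSet.par_isomorphic l S T
    have key := IsRational.par _ _
      (IsRational.single (l 0) (decide (0 ∈ S)) (decide (0 ∈ T)))
      (ih (fun i => l i.succ) (Fin.succ ⁻¹' S) (Fin.succ ⁻¹' T)
        (h.imp (fun h => by rw [h]; rfl) fun h => by rw [h]; rfl))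
    convert key using 1
    refine Set.Subset.antisymm ?_ ?_
    · rintro _ rfl
      exact ⟨ILoSet.isInterval _, _, ⟨_, _, rfl, rfl, rfl⟩, hi.symm.subsumed⟩
    · rintro R ⟨-, _, ⟨P, Q, hP, hQ, rfl⟩, hR⟩
      induction R using Quotient.inductionOn with
      | h R =>
      have hR : R.Subsumed (P.par Q) := hR
      have hP : P.Isomorphic _ := Quotient.exact hP
      have hQ : Q.Isomorphic _ := Quotient.exact hQ
      have hR := (hR.trans (hP.subsumed.par hQ.subsumed)).trans hi.subsumed
      refine Quotient.sound (hR.isomorphic_of_discrete fun x y hxy => ?_)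
      obtain ⟨f, hf⟩ := hR
      rcases h with rfl | rfl
      · exact R.S_minimal y ((hf.S_iff y).1 trivial) x hxy
      · exact R.T_maximal x ((hf.T_iff x).1 trivial) y hxy

theorem IsRational.biUnion {Λ : Type u} {ι : Type*} {s : Set ι} (hs : s.Finite)
    (L : ι → Set (Ipomset Λ)) (h : ∀ i ∈ s, IsRational (L i)) : IsRational (⋃ i ∈ s, L i) := by
  induction s, hs using Set.Finite.induction_on with
  | empty => simpa using IsRational.empty
  | @insert a s _ _ ih =>
    rw [Set.biUnion_insert]
    exact IsRational.union _ _ (h a (Set.mem_insert a s))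
      (ih fun i hi => h i (Set.mem_insert_of_mem a hi))

theorem IsRational.of_finite {Λ : Type u} {L : Set (Ipomset Λ)} (hL : L.Finite)
    (h : ∀ P ∈ L, IsRational {P}) : IsRational L := by
  have := IsRational.biUnion hL (fun P => {P}) h
  rwa [Set.biUnion_of_singleton] at this

/-! ### Gluing and Kleene plus on languages. -/

theorem langGlue_mono {Λ : Type u} {L L' M M' : Set (Ipomset Λ)} (hL : L ⊆ L') (hM : M ⊆ M') :
    langGlue L M ⊆ langGlue L' M' := by
  rintro R ⟨hR, _, ⟨P, Q, f, hP, hQ, rfl⟩, hs⟩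
  exact ⟨hR, _, ⟨P, Q, f, hL hP, hM hQ, rfl⟩, hs⟩

theorem langGlue_union_right {Λ : Type u} (L M N : Set (Ipomset Λ)) :
    langGlue L (M ∪ N) ⊆ langGlue L M ∪ langGlue L N := by
  rintro R ⟨hR, _, ⟨P, Q, f, hP, hQ | hQ, rfl⟩, hs⟩
  · exact Or.inl ⟨hR, _, ⟨P, Q, f, hP, hQ, rfl⟩, hs⟩
  · exact Or.inr ⟨hR, _, ⟨P, Q, f, hP, hQ, rfl⟩, hs⟩

/-- If `W ⊑ Q * R`, then `P * W ⊑ P * (Q * R) ⊑ (P * Q) * R`. The interval hypotheses place `P * Q`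
itself in the down-closed language `langGlue L M`. -/
theorem langGlue_langGlue_subset {Λ : Type u} {L M : Set (Ipomset Λ)} (N : Set (Ipomset Λ))
    (hL : ∀ P ∈ L, P.IsInterval) (hM : ∀ P ∈ M, P.IsInterval) :
    langGlue L (langGlue M N) ⊆ langGlue (langGlue L M) N := by
  rintro Z ⟨hZ, _, ⟨P, W, f, hP, ⟨-, _, ⟨Q, R, g, hQ, hR, rfl⟩, hW⟩, rfl⟩, hs⟩
  have hW : W.Subsumed (Q.glue R g) := hW
  obtain ⟨k, hk⟩ := hW
  let f₁ : P.Matching (Q.glue R g) := LoIso.trans f hk.srcIso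
  obtain ⟨f₂, g₂, hsub⟩ := P.glue_assoc_subsumed Q R g f₁
  have hWR := Iposet.Subsumed.glue_right ⟨k, hk⟩ f f₁
  refine ⟨hZ, _, ⟨P.glue Q f₂, R, g₂, ⟨?_, _, ⟨P, Q, f₂, hP, hQ, rfl⟩, ?_⟩, hR, rfl⟩, ?_⟩
  · exact Iposet.IsInterval.glue (hL _ hP) (hM _ hQ) f₂
  · exact Iposet.Subsumed.refl _
  · induction Z using Quotient.inductionOn with
    | h Z => exact Iposet.Subsumed.trans hs (hWR.trans hsub)

theorem langGlue_langPlus_subset {Λ : Type u} {L : Set (Ipomset Λ)} (N : Set (Ipomset Λ))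
    (hL : ∀ P ∈ L, P.IsInterval) :
    langGlue L (langGlue (langPlus L) N) ⊆ langGlue (langPlus L) N := by
  have hpow : ∀ n, ∀ P ∈ langPow L n, P.IsInterval
    | 0 => hL
    | _ + 1 => fun _ hP => hP.1
  refine (langGlue_langGlue_subset N hL fun P hP => ?_).trans (langGlue_mono ?_ subset_rfl)
  · obtain ⟨n, hn⟩ := Set.mem_iUnion.1 hP
    exact hpow n P hn
  · rintro R ⟨hR, _, ⟨P, Q, f, hP, hQ, rfl⟩, hs⟩
    obtain ⟨n, hn⟩ := Set.mem_iUnion.1 hQ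
    exact Set.mem_iUnion.2 ⟨n + 1, hR, _, ⟨P, Q, f, hP, hn, rfl⟩, hs⟩

/-! ### Realized languages and Kleene's construction. -/

/-- The interval ipomsets that are realized in `X` from `x` to `y`. -/
def realized {Λ : Type u} (X : IpcSet.{u, w} Λ) (x y : X.Cell) : Set (Ipomset Λ) :=
  {P | P.IsInterval ∧ ∃ P₀, P = Ipomset.mk P₀ ∧ Nonempty (Realization X P₀ x y)}

theorem mem_realized {Λ : Type u} {X : IpcSet.{u, w} Λ} {x y : X.Cell} {P : Iposet Λ} :
    Ipomset.mk P ∈ realized X x y ↔ P.IsInterval ∧ Nonempty (Realization X P x y) := by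
  refine ⟨fun ⟨hP, P₀, e, ⟨R⟩⟩ => ⟨hP, R.of_subsumed ?_⟩, fun ⟨hP, hR⟩ => ⟨hP, P, rfl, hR⟩⟩
  exact Iposet.Isomorphic.subsumed (Quotient.exact e)

/-- Realizations compose, and the down-closure in `langGlue` is absorbed by inheritance along
subsumptions. -/
theorem langGlue_realized_subset {Λ : Type u} {X : IpcSet.{u, w} Λ} (x y z : X.Cell) :
    langGlue (realized X x z) (realized X z y) ⊆ realized X x y := by
  rintro W ⟨hW, _, ⟨P, Q, f, hP, hQ, rfl⟩, hs⟩
  induction W using Quotient.inductionOn with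
  | h W =>
  obtain ⟨-, ⟨R₁⟩⟩ := mem_realized.1 hP
  obtain ⟨-, ⟨R₂⟩⟩ := mem_realized.1 hQ
  obtain ⟨R⟩ := R₁.glue R₂ f
  exact mem_realized.2 ⟨hW, R.of_subsumed hs⟩

theorem langPlus_realized_subset {Λ : Type u} {X : IpcSet.{u, w} Λ} {x : X.Cell}
    {L : Set (Ipomset Λ)} (hL : L ⊆ realized X x x) : langPlus L ⊆ realized X x x := by
  refine Set.iUnion_subset fun n => ?_
  induction n with
  | zero => exact hL
  | succ n ih => exact (langGlue_mono hL ih).trans (langGlue_realized_subset x x x)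

/-- The ipomsets of the steps from `x` to `y`. -/
def stepLang {Λ : Type u} (X : IpcSet.{u, w} Λ) (x y : X.Cell) : Set (Ipomset Λ) :=
  {P | ∃ s : Step X x y, P = Ipomset.mk s.ev}

/-- The identity ipomset of `x` if `x = y`. -/
def identityLang {Λ : Type u} (X : IpcSet.{u, w} Λ) (x y : X.Cell) : Set (Ipomset Λ) :=
  {P | x = y ∧ P = Ipomset.mk (x.1.withInterfaces Set.univ Set.univ).toIposet}

theorem Step.isInterval_ev {Λ : Type u} {X : IpcSet.{u, w} Λ} {x y : X.Cell} (s : Step X x y) :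
    s.ev.IsInterval := by
  cases s <;> exact ILoSet.isInterval _

/-- The ipomset of a step between two given cells depends only on its direction and on a subset of
finitely many events, so finitely many ipomsets arise. -/
theorem IsRational.stepLang {Λ : Type u} (X : IpcSet.{u, w} Λ) (x y : X.Cell) :
    IsRational (stepLang X x y) := by
  apply IsRational.of_finite
  · refine Set.Finite.subset (Set.Finite.union
      (Set.finite_range fun A : Set (Fin y.1.n) =>
        Ipomset.mk (y.1.withInterfaces Aᶜ Set.univ).toIposet)
      (Set.finite_range fun B : Set (Fin x.1.n) =>
        Ipomset.mk (x.1.withInterfaces Set.univ Bᶜ).toIposet)) ?_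
    rintro _ ⟨s, rfl⟩
    cases s with
    | up φ hB h => exact Or.inl ⟨φ.A, rfl⟩
    | down φ hA h => exact Or.inr ⟨φ.B, rfl⟩
  · rintro _ ⟨s, rfl⟩
    cases s with
    | up φ hB h => exact IsRational.discrete _ _ _ (Or.inr rfl)
    | down φ hA h => exact IsRational.discrete _ _ _ (Or.inl rfl)

theorem IsRational.identityLang {Λ : Type u} (X : IpcSet.{u, w} Λ) (x y : X.Cell) :
    IsRational (identityLang X x y) := by
  apply IsRational.of_finite
  · refine Set.Finite.subset (Set.finite_singleton
      (Ipomset.mk (x.1.withInterfaces Set.univ Set.univ).toIposet)) ?_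
    rintro _ ⟨-, rfl⟩
    rfl
  · rintro _ ⟨-, rfl⟩
    exact IsRational.discrete _ _ _ (Or.inr rfl)

/-- The upper cell of the step supplies all cells of the realization: one end is the face given by
the step, the other the upper cell itself. -/
theorem stepLang_subset_realized {Λ : Type u} (X : IpcSet.{u, w} Λ) (x y : X.Cell) :
    stepLang X x y ⊆ realized X x y := by
  rintro _ ⟨s, rfl⟩
  refine mem_realized.2 ⟨s.isInterval_ev, ?_⟩
  cases s with
  | up φ hB h =>
    exact Realization.of_cell y x y φ.Aᶜ Set.univ φ (compl_compl _).symm hB h (𝟙 y.1) rfl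
      Set.compl_univ.symm (by simp)
  | down φ hA h =>
    exact Realization.of_cell x x y Set.univ φ.Bᶜ (𝟙 x.1) Set.compl_univ.symm rfl (by simp) φ hA
      (compl_compl _).symm h

theorem identityLang_subset_realized {Λ : Type u} (X : IpcSet.{u, w} Λ) (x y : X.Cell) :
    identityLang X x y ⊆ realized X x y := by
  rintro _ ⟨rfl, rfl⟩
  exact mem_realized.2 ⟨ILoSet.isInterval _, Realization.of_cell x x x Set.univ Set.univ (𝟙 x.1)
    Set.compl_univ.symm rfl (by simp) (𝟙 x.1) rfl Set.compl_univ.symm (by simp)⟩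

/-- Kleene's construction: rational languages of realized ipomsets that contain the identities and
are closed under prefixing steps that end in a given finite set of cells. -/
theorem exists_rational_closed {Λ : Type u} (X : IpcSet.{u, w} Λ) {K : Set X.Cell}
    (hK : K.Finite) :
    ∃ R : X.Cell → X.Cell → Set (Ipomset Λ), (∀ x y, IsRational (R x y)) ∧
      (∀ x y, R x y ⊆ realized X x y) ∧
      (∀ x y, stepLang X x y ∪ identityLang X x y ⊆ R x y) ∧
      ∀ x y, ∀ z ∈ K, langGlue (stepLang X x z) (R z y) ⊆ R x y := by
  induction K, hK using Set.Finite.induction_on with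
  | empty =>
    exact ⟨fun x y => stepLang X x y ∪ identityLang X x y,
      fun x y => IsRational.union _ _ (IsRational.stepLang X x y) (IsRational.identityLang X x y),
      fun x y => Set.union_subset (stepLang_subset_realized X x y)
        (identityLang_subset_realized X x y), fun _ _ => subset_rfl, fun _ _ z hz => hz.elim⟩
  | @insert k K _ _ ih =>
    obtain ⟨R, rat, real, base, closed⟩ := ih
    -- `D y` collects what leads from `k` to `y` with any number of loops at `k`. The summand `R k
    -- y` accounts for zero loops, as the plus has none.
    let D : X.Cell → Set (Ipomset Λ) := fun y => R k y ∪ langGlue (langPlus (R k k)) (R k y)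
    have hD : ∀ y, D y ⊆ realized X k y := fun y => Set.union_subset (real k y)
      ((langGlue_mono (langPlus_realized_subset (real k k)) (real k y)).trans
        (langGlue_realized_subset k y k))
    have interval : ∀ x y, ∀ P ∈ R x y, P.IsInterval := fun x y P hP => (real x y hP).1
    have step : ∀ x y, stepLang X x y ⊆ R x y := fun x y =>
      Set.subset_union_left.trans (base x y)
    have intervalStep : ∀ x y, ∀ P ∈ stepLang X x y, P.IsInterval := fun x y P hP =>
      interval x y P (step x y hP)
    have loop : ∀ y, langGlue (R k k) (D y) ⊆ D y := by
      intro y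
      refine (langGlue_union_right _ _ _).trans (Set.union_subset ?_ ?_)
      · refine Set.Subset.trans (langGlue_mono ?_ subset_rfl) Set.subset_union_right
        exact fun P hP => Set.mem_iUnion.2 ⟨0, hP⟩
      · exact (langGlue_langPlus_subset _ (interval k k)).trans Set.subset_union_right
    refine ⟨fun x y => R x y ∪ langGlue (R x k) (D y), fun x y => ?_, fun x y => ?_,
      fun x y => (base x y).trans Set.subset_union_left, ?_⟩
    · exact IsRational.union _ _ (rat x y) (IsRational.glue _ _ (rat x k)
        (IsRational.union _ _ (rat k y)
          (IsRational.glue _ _ (IsRational.plus _ (rat k k)) (rat k y))))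
    · exact Set.union_subset (real x y)
        ((langGlue_mono (real x k) (hD y)).trans (langGlue_realized_subset x y k))
    · rintro x y z (rfl | hz)
      -- A step into `k` itself lies in `R x k`. What follows is in `D y`, or passes through `k`
      -- once more and is absorbed by `loop`.
      · refine Set.Subset.trans ?_ Set.subset_union_right
        refine langGlue_mono (step x z) (Set.union_subset Set.subset_union_left (loop y))
      -- A step into an older cell `z`: after rebracketing, the step is absorbed by `R z k`, by
      -- closure at the previous stage.
      · refine (langGlue_union_right _ _ _).trans (Set.union_subset_union (closed x y z hz) ?_)
        exact (langGlue_langGlue_subset _ (intervalStep x z) (interval z k)).trans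
          (langGlue_mono (closed x k z hz) subset_rfl)

theorem Path.ev_mem {Λ : Type u} {X : IpcSet.{u, w} Λ}
    {R : X.Cell → X.Cell → Set (Ipomset Λ)} (real : ∀ x y, R x y ⊆ realized X x y)
    (base : ∀ x y, identityLang X x y ⊆ R x y)
    (closed : ∀ x y z, langGlue (stepLang X x z) (R z y) ⊆ R x y) {x y : X.Cell}
    (p : Path X x y) : p.ev ∈ R x y := by
  induction p with
  | nil x => exact base x x ⟨rfl, rfl⟩
  | @cons x y z s p ih =>
    refine closed x z y ⟨?_, _, ⟨s.ev, p.evAux.1, s.tgtIso.trans p.evAux.2, ⟨s, rfl⟩, ih, rfl⟩, ?_⟩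
    · exact s.isInterval_ev.glue (real _ _ ih).1 _
    · exact Iposet.Subsumed.refl _

/-- Rational languages closed under steps into all cells contain every path ipomset. Conversely
their members are realized, hence come from paths. The language is the finite union over start and
accept cells. -/
theorem Automaton.isRational_lang {Λ : Type u} (X : Automaton.{u, w} Λ) : IsRational X.Lang := by
  have := X.finite
  obtain ⟨R, rat, real, base, closed⟩ := exists_rational_closed X.toIpc
    (Set.finite_univ (α := X.toIpc.Cell))
  have e : X.Lang = ⋃ x ∈ X.start, ⋃ y ∈ X.accept, R x y := by
    ext P
    simp only [Set.mem_iUnion, exists_prop]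
    constructor
    · rintro ⟨x, hx, y, hy, p, rfl⟩
      exact ⟨x, hx, y, hy, p.ev_mem real (fun x y => Set.subset_union_right.trans (base x y))
        fun x y z => closed x y z trivial⟩
    · rintro ⟨x, hx, y, hy, hP⟩
      induction P using Quotient.inductionOn with
      | h P =>
      obtain ⟨hi, ⟨r⟩⟩ := mem_realized.1 (real x y hP)
      obtain ⟨p, hp⟩ := r.exists_path hi
      exact ⟨x, hx, y, hy, p, Quotient.sound hp⟩
  rw [e]
  exact IsRational.biUnion (Set.toFinite _) _ fun x _ =>
    IsRational.biUnion (Set.toFinite _) _ fun y _ => rat x y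

end HigherDim

theorem mainTheorem3 {Λ : Type u} (L : Set (HigherDim.Ipomset Λ))
    (hL : HigherDim.IsRegular.{u, w} L) : HigherDim.IsRational L := by
  obtain ⟨X, -, rfl⟩ := hL
  exact X.isRational_lang
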